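/- Let $m$ be Lebesgue measure on $[0,1]$ and let $L^0$ be the space of real measurable functions on $[0,1]$ modulo a.e. equality. For a measurable $p:[0,1]\to[1,\infty)$ and $f\in L^0$ consider the Carathéodory (absolutely continuous, positive) solutions $\varphi_{f,x_0}$ on $[0,1]$ of $$\varphi(0)=x_0>0,\qquad \varphi'(t)=\frac{|f(t)|^{p(t)}}{p(t)}\,\varphi(t)^{1-p(t)}\quad\text{for a.e. }t\in[0,1].$$ If they exist for every $x_0>0$, put $\varphi_f=\lim_{x_0\searrow0}\varphi_{f,x_0}$ (the solution with initial value $0^+$) and $\|f\|_{p(\cdot)}=\varphi_f(1)$; otherwise put $\|f\|_{p(\cdot)}=\infty$. Let $L^{p(\cdot)}=\{f\in L^0:\|f\|_{p(\cdot)}<\infty\}$. Let $\|f\|_{\widetilde{L^{p(\cdot)}}}=\sup_C\|1_Cf\|_{p(\cdot)}$, the supremum being over all compact $C\subset[0,1]$ such that $p|_C$ is continuous, let $\widetilde{L^{p(\cdot)}}=\{f\in L^0:\|f\|_{\widetilde{L^{p(\cdot)}}}<\infty\}$, and let $L^{p(\cdot)}_0$ be the closure in $\widetilde{L^{p(\cdot)}}$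 of $\bigcup_{n\in\mathbb N}\{1_{\{p\le n\}}f: f\in\widetilde{L^{p(\cdot)}}\}$. Write $p^*(t)=p(t)/(p(t)-1)$, and let $a\in(1,2)$ be the solution of $a^a=e$. (1) Let $p:[0,1]\to[1,\infty)$ be measurable with $1<\operatorname{ess\,inf}p\le\operatorname{ess\,sup}p<\infty$. Then $L^{p(\cdot)}$ and $L^{p^*(\cdot)}$ are normed spaces with the norms $\|\cdot\|_{p(\cdot)}$ and $\|\cdot\|_{p^*(\cdot)}$. For each $F\in(L^{p(\cdot)})^*$ there is $f\in L^{p^*(\cdot)}$ such that for all $x\in L^{p(\cdot)}$ the function $xf$ is integrable and $$\langle F,x\rangle=\int_0^1x(t)f(t)\,dm(t),$$ and $F\mapsto f$ is a linear isomorphism of $(L^{p(\cdot)})^*$ onto $L^{p^*(\cdot)}$ with $\|F\|\le\|f\|_{p^*(\cdot)}\le(1+ae)\|F\|$. (2) Let $p:[0,1]\to(1,\infty)$ be measurable. Then $\widetilde{L^{p(\cdot)}}$ and $\widetilde{L^{p^*(\cdot)}}$ are normed spaces, and there is a linear isomorphism $F\mapsto f$ of $(L^{p(\cdot)}_0)^*$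 onto $\widetilde{L^{p^*(\cdot)}}$ such that for all $x\in L_0^{p(\cdot)}$ the function $xf$ is integrable and $\langle F,x\rangle=\int_0^1x(t)f(t)\,dm(t)$; moreover $\|F\|\le\|f\|_{\widetilde{L^{p^*(\cdot)}}}\le(1+ae)\|F\|$. -/

import Mathlib

open MeasureTheory Set Filter Topology
open scoped ENNReal

namespace OdeLp

/-- Lebesgue measure on `[0,1]`. -/
noncomputable abbrev unitMeasure : Measure ℝ := volume.restrict (Icc (0 : ℝ) 1)

/-- `L⁰`: real measurable functions on `[0,1]`, identified when they agree a.e. -/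
abbrev L0 : Type := ℝ →ₘ[unitMeasure] ℝ

/-- Right-hand side `(|f(t)|^{p(t)} / p(t)) s^{1-p(t)}` of the norm-determining ODE. -/
noncomputable def odeRhs (p f : ℝ → ℝ) (s t : ℝ) : ℝ :=
  |f t| ^ p t / p t * s ^ (1 - p t)

/-- `φ` is a (positive, absolutely continuous) Carathéodory solution on `[0,1]` of
`φ(0) = x₀`, `φ'(t) = (|f(t)|^{p(t)} / p(t)) φ(t)^{1-p(t)}`. -/
structure IsSolution (p f : ℝ → ℝ) (x₀ : ℝ) (φ : ℝ → ℝ) : Prop where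
  absCont : AbsolutelyContinuousOnInterval φ 0 1
  pos : ∀ t ∈ Icc (0 : ℝ) 1, 0 < φ t
  integrable : IntervalIntegrable (fun t => odeRhs p f (φ t) t) volume 0 1
  eq : ∀ T ∈ Icc (0 : ℝ) 1, φ T = x₀ + ∫ t in (0 : ℝ)..T, odeRhs p f (φ t) t

/-- `φ` is the solution with initial value `0⁺`: solutions exist for all initial values `x₀ > 0`
and converge pointwise on `[0,1]` to `φ` as `x₀ ↘ 0`. (That `φ` is again absolutely continuous and
solves the integral equation is then automatic, by monotone convergence.) -/
def IsZeroPlusSolution (p f φ : ℝ → ℝ) : Prop :=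
  ∃ Φ : ℝ → ℝ → ℝ, (∀ x₀ > 0, IsSolution p f x₀ (Φ x₀)) ∧
    ∀ t ∈ Icc (0 : ℝ) 1, Tendsto (fun x₀ => Φ x₀ t) (𝓝[>] 0) (𝓝 (φ t))

/-- `‖f‖_{p(·)} = φ_f(1)`, where `φ_f` is the solution with initial value `0⁺` (its values on `[0,1]`
are unique), and `‖f‖_{p(·)} = ∞` if there is no such solution. -/
noncomputable def lpNorm (p f : ℝ → ℝ) : ℝ≥0∞ :=
  ⨅ (φ : ℝ → ℝ) (_ : IsZeroPlusSolution p f φ), ENNReal.ofReal (φ 1)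

/-- The compact sets `C ⊆ [0,1]` such that the restriction of `p` to `C` is continuous. -/
def lusinSets (p : ℝ → ℝ) : Set (Set ℝ) :=
  {C | IsCompact C ∧ C ⊆ Icc 0 1 ∧ ContinuousOn p C}

/-- The norm of the tilde space: the supremum of `‖1_C f‖_{p(·)}` over the compact sets `C` on which
`p` is continuous. -/
noncomputable def tildeNorm (p f : ℝ → ℝ) : ℝ≥0∞ :=
  ⨆ C ∈ lusinSets p, lpNorm p (C.indicator f)

/-- `N` satisfies the axioms of a norm on `L⁰`, the value `∞` being allowed. -/
structure IsExtendedNorm (N : (ℝ → ℝ) → ℝ≥0∞) : Prop where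
  add_le : ∀ f g : L0, N ⇑(f + g) ≤ N ⇑f + N ⇑g
  smul : ∀ (c : ℝ) (f : L0), N ⇑(c • f) = ‖c‖ₑ * N ⇑f
  eq_zero : ∀ f : L0, N ⇑f = 0 → f = 0

/-- The linear subspace `{f ∈ L⁰ | N f < ∞}`. -/
def finiteSubmodule {N : (ℝ → ℝ) → ℝ≥0∞} (h : IsExtendedNorm N) : Submodule ℝ L0 where
  carrier := {f | N ⇑f < ∞}
  add_mem' {f g} hf hg := (h.add_le f g).trans_lt (ENNReal.add_lt_top.2 ⟨hf, hg⟩)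
  zero_mem' := by
    have := h.smul 0 0
    simp only [zero_smul, enorm_zero, zero_mul] at this
    change N _ < ∞
    rw [this]
    exact ENNReal.zero_lt_top
  smul_mem' c f hf := by
    change N _ < ∞
    rw [h.smul]
    exact ENNReal.mul_lt_top enorm_lt_top hf

/-- The normed space `{f ∈ L⁰ | N f < ∞}` with the norm `N`. -/
def FiniteSpace {N : (ℝ → ℝ) → ℝ≥0∞} (h : IsExtendedNorm N) : Type := finiteSubmodule h

section
variable {N : (ℝ → ℝ) → ℝ≥0∞} (h : IsExtendedNorm N)

/-- The underlying element of `L⁰`. -/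
def FiniteSpace.toL0 {h : IsExtendedNorm N} (f : FiniteSpace h) : L0 := Subtype.val f

noncomputable instance : AddCommGroup (FiniteSpace h) :=
  inferInstanceAs (AddCommGroup (finiteSubmodule h))

noncomputable instance : Module ℝ (FiniteSpace h) :=
  inferInstanceAs (Module ℝ (finiteSubmodule h))

noncomputable instance : Norm (FiniteSpace h) := ⟨fun f => (N ⇑f.toL0).toReal⟩

theorem FiniteSpace.core : NormedSpace.Core ℝ (FiniteSpace h) where
  norm_nonneg _ := ENNReal.toReal_nonneg
  norm_smul c f := by
    change (N ⇑(c • f.toL0)).toReal = ‖c‖ * (N ⇑f.toL0).toReal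
    rw [h.smul, ENNReal.toReal_mul, toReal_enorm]
  norm_triangle f g := by
    have hf : N ⇑f.toL0 ≠ ∞ := ne_of_lt (Subtype.property f)
    have hg : N ⇑g.toL0 ≠ ∞ := ne_of_lt (Subtype.property g)
    change (N ⇑(f.toL0 + g.toL0)).toReal ≤ (N ⇑f.toL0).toReal + (N ⇑g.toL0).toReal
    rw [← ENNReal.toReal_add hf hg]
    exact ENNReal.toReal_mono (ENNReal.add_ne_top.2 ⟨hf, hg⟩) (h.add_le _ _)
  norm_eq_zero_iff f := by
    constructor
    · intro h0
      have hf : N ⇑f.toL0 ≠ ∞ := ne_of_lt (Subtype.property f)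
      have h1 : N ⇑f.toL0 = 0 := ((ENNReal.toReal_eq_zero_iff _).1 h0).resolve_right hf
      exact Subtype.ext (h.eq_zero _ h1)
    · rintro rfl
      change (N ⇑(0 : L0)).toReal = 0
      have := h.smul 0 0
      simp only [zero_smul, enorm_zero, zero_mul] at this
      rw [this, ENNReal.toReal_zero]

noncomputable instance : NormedAddCommGroup (FiniteSpace h) :=
  NormedAddCommGroup.ofCore (FiniteSpace.core h)

noncomputable instance : NormedSpace ℝ (FiniteSpace h) :=
  NormedSpace.ofCore (FiniteSpace.core h)

end

/-- `L₀^{p(·)}`: the closure, in the tilde space, of the functions `1_{p ≤ n} f` with `n ∈ ℕ` and `f`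
in the tilde space. -/
noncomputable def lpZero (p : ℝ → ℝ) (h : IsExtendedNorm (tildeNorm p)) :
    Submodule ℝ (FiniteSpace h) :=
  (Submodule.span ℝ {g : FiniteSpace h | ∃ (n : ℕ) (f : FiniteSpace h),
    ⇑g.toL0 =ᵐ[unitMeasure] {t | p t ≤ n}.indicator ⇑f.toL0}).topologicalClosure

/-- The conjugate exponent `p*(t) = p(t) / (p(t) - 1)`. -/
noncomputable def conj (p : ℝ → ℝ) : ℝ → ℝ := fun t => Real.conjExponent (p t)

/-- The functional `F` on `V` is represented by `f`: `⟨F, x⟩ = ∫ x f dm` for all `x ∈ V`, where `ι x`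
is the function underlying `x`. -/
def Represents {V : Type} [NormedAddCommGroup V] [NormedSpace ℝ V] (ι : V → L0)
    (F : StrongDual ℝ V) (f : L0) : Prop :=
  ∀ x : V, Integrable (fun t => ι x t * f t) unitMeasure ∧
    F x = ∫ t, ι x t * f t ∂unitMeasure

end OdeLp

/-!
Both dualities are in fact isometric, `‖F‖ = ‖f‖`; the constant `1 + a e` enters only through
`1 ≤ 1 + a e`.

Bounded exponents. The right-hand side of the equation decreases in the unknown, so solutions
compare: a supersolution stays above every solution that starts below it. Hence `‖f‖_{p(·)}` is at
most the value at `1` of any positive supersolution (`lpNorm_le_of_supersolution`), and estimates of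
the norm reduce to exhibiting supersolutions. The triangle inequality follows because
`(s, φ) ↦ s ^ p φ ^ (1 - p) / p` is the perspective of a convex function, so that the sum of a
solution for `f` and a solution for `g` is a supersolution for `f + g` (`odeRhs_add_le`).

Hölder's inequality (`integral_abs_mul_le`) holds with constant `1`: if `φ` solves the equation for
`(p, x)` and `ψ` the one for `(p*, f)`, then
`(φ ψ)' = φ ψ ((|x| / φ) ^ p / p + (|f| / ψ) ^ p* / p*) ≥ |x f|` by Young's inequality. Choosing `x`
so that equality holds in Young's inequality makes the equation for `φ` linear, and shows that the
bound is sharp (`exists_norming`). On indicator functions a bounded functional is given by a density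
(Radon–Nikodym), whose norm is bounded by testing the truncations of the density and passing to the
limit (`IsBddFunctional.exists_eq_integral`).

Unbounded exponents. On a compact set `C` on which `p` is continuous, the exponent is bounded away
from `1` and `∞`, and `p` may be replaced off `C` by a constant (`lusinExponent`), which leaves
`‖1_C f‖_{p(·)}` unchanged. By Lusin's theorem such sets exhaust `[0,1]` up to a null set; the
densities representing a functional on them agree on overlaps and glue to a function of tilde norm
at most `‖F‖` (`exists_forall_lusinSets_eq_integral`). That integration against this function gives
`F` on all of `L₀^{p(·)}` follows by density: for a function supported where `p` is bounded, the
restrictions to the exhausting sets converge in norm (`tendsto_tildeNorm_indicator_compl`).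
-/

namespace OdeLp

/-! ### Primitives of integrable functions on the unit interval -/

/-- `φ` is a primitive on `[0,1]` of the integrable function `u`, i.e. `φ` is absolutely continuous
with `φ' = u` a.e.; outside `[0,1]` the values of `φ` and `u` are arbitrary. -/
structure IsPrimitive (φ u : ℝ → ℝ) : Prop where
  integrable : Integrable u unitMeasure
  eq : ∀ T ∈ Icc (0 : ℝ) 1, φ T = φ 0 + ∫ t in (0 : ℝ)..T, u t

theorem integrable_unitMeasure_iff {u : ℝ → ℝ} :
    Integrable u unitMeasure ↔ IntervalIntegrable u volume 0 1 :=
  (intervalIntegrable_iff_integrableOn_Icc_of_le zero_le_one).symm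

theorem integral_unitMeasure (u : ℝ → ℝ) :
    ∫ t, u t ∂unitMeasure = ∫ t in (0 : ℝ)..1, u t := by
  rw [intervalIntegral.integral_of_le zero_le_one, integral_Icc_eq_integral_Ioc]

theorem ae_unitMeasure_iff {P : ℝ → Prop} :
    (∀ᵐ t ∂unitMeasure, P t) ↔ ∀ᵐ t ∂(volume : Measure ℝ), t ∈ Icc (0 : ℝ) 1 → P t :=
  ae_restrict_iff' measurableSet_Icc

theorem ae_mem_unit : ∀ᵐ t ∂unitMeasure, t ∈ Icc (0 : ℝ) 1 :=
  ae_restrict_mem measurableSet_Icc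

theorem ae_mem_Ioo_unit : ∀ᵐ t ∂unitMeasure, t ∈ Ioo (0 : ℝ) 1 := by
  rw [show (unitMeasure : Measure ℝ) = volume.restrict (Ioo 0 1) from
    (Measure.restrict_congr_set Ioo_ae_eq_Icc).symm]
  exact ae_restrict_mem measurableSet_Ioo

/-- A property that holds a.e. on `[0,1]` holds a.e. on each of its subintervals. -/
theorem ae_restrict_Icc_of_ae_unitMeasure {P : ℝ → Prop} (h : ∀ᵐ t ∂unitMeasure, P t) {a b : ℝ}
    (ha : 0 ≤ a) (hb : b ≤ 1) : ∀ᵐ t ∂(volume.restrict (Icc a b)), P t :=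
  ae_mono (Measure.restrict_mono (Icc_subset_Icc ha hb) le_rfl) h

theorem integrable_intervalIntegrable {u : ℝ → ℝ} (h : Integrable u unitMeasure) {a b : ℝ}
    (ha : a ∈ Icc (0 : ℝ) 1) (hb : b ∈ Icc (0 : ℝ) 1) : IntervalIntegrable u volume a b := by
  refine (integrable_unitMeasure_iff.1 h).mono_set ?_
  rw [uIcc_of_le zero_le_one]
  exact (convex_Icc (0 : ℝ) 1).ordConnected.uIcc_subset ha hb

theorem aestronglyMeasurable_of_continuousOn {φ : ℝ → ℝ} (h : ContinuousOn φ (Icc 0 1)) :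
    AEStronglyMeasurable φ unitMeasure :=
  h.aestronglyMeasurable measurableSet_Icc

namespace IsPrimitive

variable {φ ψ u v : ℝ → ℝ}

theorem sub_eq (h : IsPrimitive φ u) {a b : ℝ} (ha : a ∈ Icc (0 : ℝ) 1) (hb : b ∈ Icc (0 : ℝ) 1) :
    φ b - φ a = ∫ t in a..b, u t := by
  have h0 : (0 : ℝ) ∈ Icc (0 : ℝ) 1 := by simp
  rw [h.eq a ha, h.eq b hb, ← intervalIntegral.integral_interval_sub_left
    (integrable_intervalIntegrable h.integrable h0 hb)
    (integrable_intervalIntegrable h.integrable h0 ha)]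
  ring

theorem integral_eq (h : IsPrimitive φ u) : ∫ t, u t ∂unitMeasure = φ 1 - φ 0 := by
  rw [integral_unitMeasure, h.sub_eq (by simp) (by simp)]

theorem absolutelyContinuous (h : IsPrimitive φ u) : AbsolutelyContinuousOnInterval φ 0 1 := by
  have h1 := (integrable_unitMeasure_iff.1
    h.integrable).absolutelyContinuousOnInterval_intervalIntegral (c := 0) (by simp)
  have h2 : AbsolutelyContinuousOnInterval (fun _ : ℝ => φ 0) 0 1 :=
    (contDiffOn_const (c := φ 0)).absolutelyContinuousOnInterval
  refine Tendsto.congr' ?_ (h2.add h1)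
  filter_upwards [mem_inf_of_right (mem_principal_self _)] with E hE
  refine Finset.sum_congr rfl fun i hi => ?_
  have := hE.1 i hi
  rw [uIcc_of_le zero_le_one] at this
  simp only [Pi.add_apply]
  rw [← h.eq _ this.1, ← h.eq _ this.2]

theorem continuousOn (h : IsPrimitive φ u) : ContinuousOn φ (Icc 0 1) := by
  simpa using h.absolutelyContinuous.continuousOn

theorem ae_hasDerivAt (h : IsPrimitive φ u) : ∀ᵐ t ∂unitMeasure, HasDerivAt φ (u t) t := by
  have h1 := (integrable_unitMeasure_iff.1 h.integrable).ae_hasDerivAt_integral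
  rw [uIcc_of_le zero_le_one] at h1
  filter_upwards [ae_unitMeasure_iff.2 h1, ae_mem_Ioo_unit] with t ht hmem
  have h2 := (ht 0 (by simp)).const_add (φ 0)
  refine h2.congr_of_eventuallyEq ?_
  filter_upwards [isOpen_Ioo.mem_nhds hmem] with s hs
  exact h.eq s (Ioo_subset_Icc_self hs)

theorem of_absolutelyContinuous (hφ : AbsolutelyContinuousOnInterval φ 0 1)
    (h : ∀ᵐ t ∂unitMeasure, HasDerivAt φ (u t) t) : IsPrimitive φ u := by
  have hd : deriv φ =ᵐ[unitMeasure] u := by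
    filter_upwards [h] with t ht using ht.deriv
  have hint : Integrable u unitMeasure :=
    (integrable_unitMeasure_iff.2 hφ.intervalIntegrable_deriv).congr hd
  refine ⟨hint, fun T hT => ?_⟩
  have hφT : AbsolutelyContinuousOnInterval φ 0 T :=
    hφ.mono (by rw [uIcc_of_le hT.1, uIcc_of_le zero_le_one]; exact Icc_subset_Icc le_rfl hT.2)
  have h1 := hφT.integral_deriv_eq_sub
  have h2 : ∫ t in (0 : ℝ)..T, deriv φ t = ∫ t in (0 : ℝ)..T, u t := by
    refine intervalIntegral.integral_congr_ae ?_
    filter_upwards [ae_unitMeasure_iff.1 hd] with t ht hmem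
    rw [uIoc_of_le hT.1] at hmem
    exact ht ⟨hmem.1.le, hmem.2.trans hT.2⟩
  linarith

theorem congr_ae (h : IsPrimitive φ u) (huv : u =ᵐ[unitMeasure] v) : IsPrimitive φ v :=
  of_absolutelyContinuous h.absolutelyContinuous (by
    filter_upwards [h.ae_hasDerivAt, huv] with t h1 h2 using h2 ▸ h1)

theorem add (h : IsPrimitive φ u) (k : IsPrimitive ψ v) :
    IsPrimitive (fun t => φ t + ψ t) (fun t => u t + v t) :=
  of_absolutelyContinuous (h.absolutelyContinuous.add k.absolutelyContinuous) (by
    filter_upwards [h.ae_hasDerivAt, k.ae_hasDerivAt] with t h1 h2 using h1.add h2)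

theorem mul (h : IsPrimitive φ u) (k : IsPrimitive ψ v) :
    IsPrimitive (fun t => φ t * ψ t) (fun t => u t * ψ t + φ t * v t) :=
  of_absolutelyContinuous (h.absolutelyContinuous.mul k.absolutelyContinuous) (by
    filter_upwards [h.ae_hasDerivAt, k.ae_hasDerivAt] with t h1 h2 using h1.mul h2)

theorem const_mul (h : IsPrimitive φ u) (c : ℝ) :
    IsPrimitive (fun t => c * φ t) (fun t => c * u t) :=
  of_absolutelyContinuous (h.absolutelyContinuous.const_mul c) (by
    filter_upwards [h.ae_hasDerivAt] with t h1 using h1.const_mul c)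

theorem add_const (h : IsPrimitive φ u) (c : ℝ) : IsPrimitive (fun t => φ t + c) u :=
  ⟨h.integrable, fun T hT => by rw [h.eq T hT]; ring⟩

theorem of_integrable (hu : Integrable u unitMeasure) (c : ℝ) :
    IsPrimitive (fun T => c + ∫ t in (0 : ℝ)..T, u t) u :=
  ⟨hu, fun T _ => by simp⟩

/-- Absolute continuity is preserved by composition with a function that is Lipschitz on a ball
containing the range, such as the exponential function. -/
theorem exp (h : IsPrimitive φ u) :
    IsPrimitive (fun t => Real.exp (φ t)) (fun t => Real.exp (φ t) * u t) := by
  refine of_absolutelyContinuous ?_ (by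
    filter_upwards [h.ae_hasDerivAt] with t h1 using h1.exp)
  obtain ⟨C, hC⟩ := h.absolutelyContinuous.exists_bound
  obtain ⟨K, hK⟩ := (Real.contDiff_exp (n := 1)).contDiffOn.exists_lipschitzOnWith
    (s := Icc (-C) C) (by decide) (convex_Icc _ _) isCompact_Icc
  have hlim := h.absolutelyContinuous
  unfold AbsolutelyContinuousOnInterval at hlim ⊢
  have hlim' := hlim.const_mul (K : ℝ)
  rw [mul_zero] at hlim'
  refine squeeze_zero' (Eventually.of_forall fun E => Finset.sum_nonneg fun _ _ => dist_nonneg)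
    ?_ hlim'
  filter_upwards [mem_inf_of_right (mem_principal_self _)] with E hE
  rw [Finset.mul_sum]
  refine Finset.sum_le_sum fun i hi => hK.dist_le_mul _ ?_ _ ?_
  · exact abs_le.1 (hC _ (hE.1 i hi).1)
  · exact abs_le.1 (hC _ (hE.1 i hi).2)

theorem mono (h : IsPrimitive φ u) (hu : ∀ᵐ t ∂unitMeasure, 0 ≤ u t) {a b : ℝ} (ha : 0 ≤ a)
    (hab : a ≤ b) (hb : b ≤ 1) : φ a ≤ φ b := by
  have h1 := h.sub_eq ⟨ha, hab.trans hb⟩ ⟨ha.trans hab, hb⟩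
  have h2 : 0 ≤ ∫ t in a..b, u t :=
    intervalIntegral.integral_nonneg_of_ae_restrict hab (ae_restrict_Icc_of_ae_unitMeasure hu ha hb)
  linarith

/-- The power rule for primitives. -/
theorem pow_succ (h : IsPrimitive φ u) (n : ℕ) :
    IsPrimitive (fun t => φ t ^ (n + 1)) (fun t => (n + 1) * φ t ^ n * u t) := by
  induction n with
  | zero => simpa using h
  | succ n ih =>
    have h1 := ih.mul h
    have e1 : (fun t => φ t ^ (n + 1 + 1)) = fun t => φ t ^ (n + 1) * φ t := by
      funext t; ring
    rw [e1]
    refine h1.congr_ae (Eventually.of_forall fun t => ?_)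
    push_cast
    ring

/-- Comparison principle: if `φ 0 ≤ ψ 0` and `φ' ≤ ψ'` wherever `ψ ≤ φ`, then `φ ≤ ψ`. Past the
last point before `t` at which `φ ≤ ψ`, the difference `φ - ψ` could not increase. -/
theorem le_of_deriv_le (h : IsPrimitive φ u) (k : IsPrimitive ψ v) (h0 : φ 0 ≤ ψ 0)
    (hle : ∀ᵐ t ∂unitMeasure, ψ t ≤ φ t → u t ≤ v t) : ∀ t ∈ Icc (0 : ℝ) 1, φ t ≤ ψ t := by
  intro t ht
  by_contra! hlt
  have hcont : ContinuousOn (fun s => φ s - ψ s) (Icc 0 t) :=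
    (h.continuousOn.sub k.continuousOn).mono (Icc_subset_Icc le_rfl ht.2)
  set S : Set ℝ := Icc 0 t ∩ (fun s => φ s - ψ s) ⁻¹' Iic 0
  have hScl : IsClosed S := hcont.preimage_isClosed_of_isClosed isClosed_Icc isClosed_Iic
  have hSne : S.Nonempty := ⟨0, ⟨le_rfl, ht.1⟩, by simpa using h0⟩
  have hSbdd : BddAbove S := ⟨t, fun s hs => hs.1.2⟩
  have hmem : sSup S ∈ S := hScl.csSup_mem hSne hSbdd
  set s := sSup S
  have hs1 : s ∈ Icc (0 : ℝ) 1 := ⟨hmem.1.1, hmem.1.2.trans ht.2⟩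
  have hd : φ s - ψ s ≤ 0 := hmem.2
  have hint : ∫ x in s..t, u x ≤ ∫ x in s..t, v x := by
    refine intervalIntegral.integral_mono_ae_restrict hmem.1.2
      (integrable_intervalIntegrable h.integrable hs1 ht)
      (integrable_intervalIntegrable k.integrable hs1 ht) ?_
    have h1 := ae_restrict_Icc_of_ae_unitMeasure hle hs1.1 ht.2
    have h2 : ∀ᵐ x ∂(volume.restrict (Icc s t)), x ∈ Ioc s t := by
      rw [Measure.restrict_congr_set Ioc_ae_eq_Icc.symm]
      exact ae_restrict_mem measurableSet_Ioc
    filter_upwards [h1, h2] with x hx hxm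
    refine hx ?_
    by_contra! hc
    have : x ∈ S := ⟨⟨hs1.1.trans hxm.1.le, hxm.2⟩, by simpa using hc.le⟩
    exact absurd (le_csSup hSbdd this) (not_le.2 hxm.1)
  rw [← h.sub_eq hs1 ht, ← k.sub_eq hs1 ht] at hint
  linarith

end IsPrimitive

/-! ### Existence of Carathéodory solutions -/

/-- Carathéodory's existence theorem for a right-hand side `h t s` that is Lipschitz in `s` with an
integrable Lipschitz constant `K t`: some iterate of the Picard operator contracts, as the `n`-th
iterate has Lipschitz constant `(∫ K)ⁿ / n!`. -/
theorem exists_isPrimitive_of_lipschitz {h : ℝ → ℝ → ℝ} {K : ℝ → ℝ}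
    (hK : Integrable K unitMeasure) (hK0 : ∀ t, 0 ≤ K t)
    (hmeas : ∀ φ : ℝ → ℝ, Continuous φ → Integrable (fun t => h t (φ t)) unitMeasure)
    (hlip : ∀ᵐ t ∂unitMeasure, ∀ a b, |h t a - h t b| ≤ K t * |a - b|) (x₀ : ℝ) :
    ∃ φ : ℝ → ℝ, φ 0 = x₀ ∧ IsPrimitive φ (fun t => h t (φ t)) := by
  have h01 : (0 : ℝ) ≤ 1 := zero_le_one
  let ext : C(Icc (0 : ℝ) 1, ℝ) → ℝ → ℝ := fun φ => IccExtend h01 φ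
  have hext : ∀ φ, Continuous (ext φ) := fun φ => φ.continuous.Icc_extend'
  have hextd : ∀ φ ψ t, |ext φ t - ext ψ t| ≤ dist φ ψ := fun φ ψ t => by
    rw [← Real.dist_eq]; exact ContinuousMap.dist_apply_le_dist _
  let P : C(Icc (0 : ℝ) 1, ℝ) → ℝ → ℝ := fun φ T => x₀ + ∫ t in (0 : ℝ)..T, h t (ext φ t)
  have hP : ∀ φ, IsPrimitive (P φ) (fun t => h t (ext φ t)) := fun φ =>
    IsPrimitive.of_integrable (hmeas _ (hext φ)) x₀
  let Φ : C(Icc (0 : ℝ) 1, ℝ) → C(Icc (0 : ℝ) 1, ℝ) := fun φ =>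
    ⟨fun t => P φ t, (hP φ).continuousOn.domRestrict⟩
  have hΦ : ∀ φ, ∀ t ∈ Icc (0 : ℝ) 1, ext (Φ φ) t = P φ t := fun φ t ht =>
    IccExtend_of_mem _ _ ht
  let L : ℝ → ℝ := fun T => 0 + ∫ t in (0 : ℝ)..T, K t
  have hL : IsPrimitive L K := IsPrimitive.of_integrable hK 0
  have hL0 : L 0 = 0 := by simp [L]
  have hLnn : ∀ t ∈ Icc (0 : ℝ) 1, 0 ≤ L t := fun t ht =>
    hL0 ▸ hL.mono (Eventually.of_forall hK0) le_rfl ht.1 ht.2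
  have key : ∀ (n : ℕ) φ ψ, ∀ T ∈ Icc (0 : ℝ) 1,
      |ext (Φ^[n] φ) T - ext (Φ^[n] ψ) T| ≤ L T ^ n / n.factorial * dist φ ψ := by
    intro n φ ψ
    induction n with
    | zero => intro T _; simpa using hextd φ ψ T
    | succ n ih =>
      intro T hT
      have h0 : (0 : ℝ) ∈ Icc (0 : ℝ) 1 := by simp
      rw [Function.iterate_succ_apply', Function.iterate_succ_apply', hΦ _ T hT, hΦ _ T hT]
      have i1 := integrable_intervalIntegrable (hP (Φ^[n] φ)).integrable h0 hT
      have i2 := integrable_intervalIntegrable (hP (Φ^[n] ψ)).integrable h0 hT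
      have e1 : P (Φ^[n] φ) T - P (Φ^[n] ψ) T =
          ∫ t in (0 : ℝ)..T, (h t (ext (Φ^[n] φ) t) - h t (ext (Φ^[n] ψ) t)) := by
        rw [intervalIntegral.integral_sub i1 i2]
        simp [P]
      have hpow := (hL.pow_succ n).const_mul (dist φ ψ / (n + 1).factorial)
      have e2 := hpow.sub_eq h0 hT
      rw [e1]
      refine (intervalIntegral.norm_integral_le_of_norm_le hT.1 (f := fun t =>
        h t (ext (Φ^[n] φ) t) - h t (ext (Φ^[n] ψ) t)) ?_
        (integrable_intervalIntegrable hpow.integrable h0 hT)).trans (le_of_eq ?_)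
      · filter_upwards [ae_unitMeasure_iff.1 hlip] with t ht htm
        have htI : t ∈ Icc (0 : ℝ) 1 := ⟨htm.1.le, htm.2.trans hT.2⟩
        refine (ht htI _ _).trans ((mul_le_mul_of_nonneg_left (ih t htI) (hK0 t)).trans
          (le_of_eq ?_))
        rw [Nat.factorial_succ]
        push_cast
        have : (n.factorial : ℝ) ≠ 0 := by positivity
        field_simp
      · rw [← e2, hL0]
        simp
        ring
  obtain ⟨n, hn⟩ : ∃ n : ℕ, L 1 ^ n / n.factorial < 1 :=
    ((FloorSemiring.tendsto_pow_div_factorial_atTop (L 1)).eventually_lt_const one_pos).exists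
  have hq0 : 0 ≤ L 1 ^ n / n.factorial := by
    have := hLnn 1 (by simp)
    positivity
  have hcontr : ContractingWith ⟨L 1 ^ n / n.factorial, hq0⟩ (Φ^[n]) := by
    refine ⟨by exact_mod_cast hn, LipschitzWith.of_dist_le_mul fun φ ψ => ?_⟩
    rw [ContinuousMap.dist_le (by positivity)]
    intro t
    have h1 := key n φ ψ t t.2
    simp only [ext, IccExtend_val] at h1
    rw [Real.dist_eq]
    refine h1.trans ?_
    have h2 : L t ≤ L 1 := hL.mono (Eventually.of_forall hK0) t.2.1 t.2.2 le_rfl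
    have h3 := hLnn t t.2
    change _ ≤ L 1 ^ n / n.factorial * dist φ ψ
    gcongr
  have : Nonempty C(Icc (0 : ℝ) 1, ℝ) := ⟨0⟩
  have hfix : Φ (hcontr.fixedPoint Φ^[n]) = hcontr.fixedPoint Φ^[n] :=
    hcontr.isFixedPt_fixedPoint_iterate
  set φ := hcontr.fixedPoint Φ^[n]
  have hval : ∀ t ∈ Icc (0 : ℝ) 1, ext φ t = P φ t := fun t ht => by
    conv_lhs => rw [← hfix]
    exact hΦ φ t ht
  have hv0 : ext φ 0 = x₀ := by rw [hval 0 (by simp)]; simp [P]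
  refine ⟨ext φ, hv0, hmeas _ (hext φ), fun T hT => ?_⟩
  rw [hval T hT, hv0]

end OdeLp

namespace OdeLp

/-! ### The norm-determining equation for bounded exponents -/

/-- `p` is a measurable exponent on `[0,1]` with `1 < ess inf p ≤ ess sup p < ∞`. -/
structure IsBddExponent (p : ℝ → ℝ) : Prop where
  aemeasurable : AEMeasurable p unitMeasure
  bdd : ∃ r R : ℝ, 1 < r ∧ ∀ᵐ t ∂unitMeasure, r ≤ p t ∧ p t ≤ R

theorem IsBddExponent.one_lt {p : ℝ → ℝ} (hp : IsBddExponent p) : ∀ᵐ t ∂unitMeasure, 1 < p t := by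
  obtain ⟨r, R, hr, h⟩ := hp.bdd
  filter_upwards [h] with t ht using hr.trans_le ht.1

theorem IsBddExponent.exists_le {p : ℝ → ℝ} (hp : IsBddExponent p) :
    ∃ R : ℝ, 1 ≤ R ∧ ∀ᵐ t ∂unitMeasure, p t ≤ R := by
  obtain ⟨r, R, hr, h⟩ := hp.bdd
  refine ⟨max 1 R, le_max_left _ _, ?_⟩
  filter_upwards [h] with t ht using ht.2.trans (le_max_right _ _)

variable {p f g φ ψ v : ℝ → ℝ} {x₀ : ℝ}

theorem abs_rpow_mul_rpow_one_sub {a s q : ℝ} (ha : 0 ≤ a) (hs : 0 < s) :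
    a ^ q * s ^ (1 - q) = s * (a / s) ^ q := by
  rw [Real.div_rpow ha hs.le, Real.rpow_sub hs, Real.rpow_one]
  ring

theorem odeRhs_eq {s t : ℝ} (hs : 0 < s) : odeRhs p f s t = s * (|f t| / s) ^ p t / p t := by
  rw [odeRhs, div_mul_eq_mul_div, abs_rpow_mul_rpow_one_sub (abs_nonneg _) hs]

theorem abs_rpow_eq_mul_odeRhs {s t : ℝ} (hp : p t ≠ 0) (hs : 0 < s) :
    |f t| ^ p t = p t * s ^ (p t - 1) * odeRhs p f s t := by
  have h : s ^ (p t - 1) * s ^ (1 - p t) = 1 := by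
    rw [← Real.rpow_add hs]; simp
  rw [odeRhs]
  calc |f t| ^ p t = |f t| ^ p t * (p t / p t) * 1 := by rw [div_self hp]; ring
    _ = |f t| ^ p t * (p t / p t) * (s ^ (p t - 1) * s ^ (1 - p t)) := by rw [h]
    _ = _ := by ring

theorem odeRhs_nonneg {s t : ℝ} (hp : 1 ≤ p t) (hs : 0 ≤ s) : 0 ≤ odeRhs p f s t := by
  unfold odeRhs
  have : 0 ≤ p t := by linarith
  positivity

theorem odeRhs_of_eq_zero {s t : ℝ} (hp : p t ≠ 0) (hf : f t = 0) : odeRhs p f s t = 0 := by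
  simp [odeRhs, hf, Real.zero_rpow hp]

theorem odeRhs_anti {s s' t : ℝ} (hp : 1 ≤ p t) (hs : 0 < s) (hss : s ≤ s') :
    odeRhs p f s' t ≤ odeRhs p f s t := by
  unfold odeRhs
  have h0 : 0 ≤ p t := by linarith
  have := Real.rpow_le_rpow_of_nonpos hs hss (by linarith : 1 - p t ≤ 0)
  gcongr

theorem odeRhs_mono_abs {s t : ℝ} (hp : 1 ≤ p t) (hs : 0 < s) (h : |f t| ≤ |g t|) :
    odeRhs p f s t ≤ odeRhs p g s t := by
  unfold odeRhs
  have h0 : 0 ≤ p t := by linarith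
  gcongr

/-- Joint subadditivity of the right-hand side in the function and the solution: the perspective of
the convex function `x ↦ xᵖ` is subadditive. -/
theorem odeRhs_add_le {s s' t : ℝ} (hp : 1 ≤ p t) (hs : 0 < s) (hs' : 0 < s') :
    odeRhs p (fun t => f t + g t) (s + s') t ≤ odeRhs p f s t + odeRhs p g s' t := by
  have h0 : 0 < p t := by linarith
  have hss : 0 < s + s' := by linarith
  rw [odeRhs_eq hss, odeRhs_eq hs, odeRhs_eq hs', ← add_div]
  refine div_le_div_of_nonneg_right ?_ h0.le
  have hmem : ∀ {a r : ℝ}, 0 < r → |a| / r ∈ Ici (0 : ℝ) := fun hr =>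
    div_nonneg (abs_nonneg _) hr.le
  have hsum : s / (s + s') + s' / (s + s') = 1 := by field_simp
  have hconv := (convexOn_rpow hp).2 (hmem (a := f t) hs) (hmem (a := g t) hs')
    (div_nonneg hs.le hss.le) (div_nonneg hs'.le hss.le) hsum
  simp only [smul_eq_mul] at hconv
  have e1 : s / (s + s') * (|f t| / s) + s' / (s + s') * (|g t| / s')
      = (|f t| + |g t|) / (s + s') := by field_simp
  rw [e1] at hconv
  calc (s + s') * (|f t + g t| / (s + s')) ^ p t
      ≤ (s + s') * ((|f t| + |g t|) / (s + s')) ^ p t := by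
        gcongr
        exact abs_add_le _ _
    _ ≤ (s + s') * (s / (s + s') * (|f t| / s) ^ p t + s' / (s + s') * (|g t| / s') ^ p t) := by
        gcongr
    _ = _ := by field_simp

theorem aemeasurable_odeRhs (hp : AEMeasurable p unitMeasure) (hf : AEMeasurable f unitMeasure)
    (hφ : AEMeasurable φ unitMeasure) :
    AEMeasurable (fun t => odeRhs p f (φ t) t) unitMeasure :=
  (((hf.norm.pow hp)).div hp).mul (hφ.pow (hp.const_sub 1))

theorem aemeasurable_modular (hp : AEMeasurable p unitMeasure) (hf : AEMeasurable f unitMeasure) :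
    AEMeasurable (fun t => |f t| ^ p t) unitMeasure :=
  hf.norm.pow hp

theorem rpow_le_max_rpow {y e E : ℝ} (hy : 0 < y) (he : |e| ≤ E) : y ^ e ≤ max y y⁻¹ ^ E := by
  have h1 : 1 ≤ max y y⁻¹ := by
    rcases le_total 1 y with h | h
    · exact h.trans (le_max_left _ _)
    · exact (one_le_inv_iff₀.2 ⟨hy, h⟩).trans (le_max_right _ _)
  refine le_trans ?_ (Real.rpow_le_rpow_of_exponent_le h1 he)
  rcases le_total 0 e with h | h
  · rw [abs_of_nonneg h]
    exact Real.rpow_le_rpow hy.le (le_max_left _ _) h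
  · rw [abs_of_nonpos h, ← neg_neg e, Real.rpow_neg hy.le, ← Real.inv_rpow hy.le, neg_neg]
    exact Real.rpow_le_rpow (by positivity) (le_max_right _ _) (by linarith)

theorem isSolution_iff : IsSolution p f x₀ φ ↔
    IsPrimitive φ (fun t => odeRhs p f (φ t) t) ∧ φ 0 = x₀ ∧ ∀ t ∈ Icc (0 : ℝ) 1, 0 < φ t := by
  constructor
  · intro h
    have h0 : φ 0 = x₀ := by simpa using h.eq 0 (by simp)
    refine ⟨⟨integrable_unitMeasure_iff.2 h.integrable, fun T hT => ?_⟩, h0, h.pos⟩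
    rw [h0]
    exact h.eq T hT
  · rintro ⟨h1, h2, h3⟩
    refine ⟨h1.absolutelyContinuous, h3, integrable_unitMeasure_iff.1 h1.integrable, ?_⟩
    subst h2
    exact h1.eq

theorem lpNorm_congr_odeRhs {p' f' : ℝ → ℝ}
    (h : ∀ᵐ t ∂unitMeasure, ∀ s > 0, odeRhs p f s t = odeRhs p' f' s t) :
    lpNorm p f = lpNorm p' f' := by
  have h1 : ∀ x φ, IsSolution p f x φ ↔ IsSolution p' f' x φ := by
    intro x φ
    rw [isSolution_iff, isSolution_iff]
    have key : (∀ t ∈ Icc (0 : ℝ) 1, 0 < φ t) → (fun t => odeRhs p f (φ t) t) =ᵐ[unitMeasure]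
        fun t => odeRhs p' f' (φ t) t := fun hpos => by
      filter_upwards [h, ae_mem_unit] with t ht htm using ht _ (hpos t htm)
    exact ⟨fun ⟨a, b, c⟩ => ⟨a.congr_ae (key c), b, c⟩,
      fun ⟨a, b, c⟩ => ⟨a.congr_ae (key c).symm, b, c⟩⟩
  simp only [lpNorm, IsZeroPlusSolution, h1]

theorem lpNorm_congr (h : f =ᵐ[unitMeasure] g) : lpNorm p f = lpNorm p g :=
  lpNorm_congr_odeRhs (by filter_upwards [h] with t ht s _; simp only [odeRhs, ht])

/-- Solutions exist for every positive initial value as soon as the modular `∫ |f|ᵖ` is finite: on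
`[x₀, ∞)` the right-hand side is Lipschitz with an integrable constant. -/
theorem exists_isSolution (hp : IsBddExponent p) (hf : AEMeasurable f unitMeasure)
    (hint : Integrable (fun t => |f t| ^ p t) unitMeasure) (hx : 0 < x₀) :
    ∃ φ, IsSolution p f x₀ φ := by
  obtain ⟨R, hR1, hR⟩ := hp.exists_le
  set B : ℝ := max x₀ x₀⁻¹ ^ R
  have hB : 0 ≤ B := by positivity
  have hmeasK : AEMeasurable (fun t => |f t| ^ p t / p t * ((p t - 1) * x₀ ^ (-p t)))
      unitMeasure :=
    ((aemeasurable_modular hp.aemeasurable hf).div hp.aemeasurable).mul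
      ((hp.aemeasurable.sub_const 1).mul ((aemeasurable_const (b := x₀)).pow hp.aemeasurable.neg))
  have hK : Integrable (fun t => |(|f t| ^ p t / p t * ((p t - 1) * x₀ ^ (-p t)))|)
      unitMeasure := by
    refine (Integrable.mono' (hint.const_mul B) hmeasK.aestronglyMeasurable ?_).abs
    filter_upwards [hp.one_lt, hR] with t h1 h2
    have h0 : 0 < p t := by linarith
    have hx1 : x₀ ^ (-p t) ≤ B := rpow_le_max_rpow hx (by rw [abs_neg, abs_of_pos h0]; exact h2)
    have hnn : 0 ≤ |f t| ^ p t / p t * ((p t - 1) * x₀ ^ (-p t)) :=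
      mul_nonneg (by positivity) (mul_nonneg (by linarith) (by positivity))
    rw [Real.norm_of_nonneg hnn]
    have : (p t - 1) / p t ≤ 1 := by rw [div_le_one h0]; linarith
    calc |f t| ^ p t / p t * ((p t - 1) * x₀ ^ (-p t))
        = x₀ ^ (-p t) * (|f t| ^ p t) * ((p t - 1) / p t) := by ring
      _ ≤ B * (|f t| ^ p t) * 1 := by
        have : 0 ≤ (p t - 1) / p t := div_nonneg (by linarith) h0.le
        gcongr
      _ = _ := mul_one _
  have hmeas : ∀ φ : ℝ → ℝ, Continuous φ →
      Integrable (fun t => odeRhs p f (max (φ t) x₀) t) unitMeasure := by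
    intro φ hφ
    refine Integrable.mono' (hint.const_mul B) (aemeasurable_odeRhs hp.aemeasurable hf
      (hφ.max continuous_const).aemeasurable).aestronglyMeasurable ?_
    filter_upwards [hp.one_lt, hR] with t h1 h2
    have hm : x₀ ≤ max (φ t) x₀ := le_max_right _ _
    rw [Real.norm_of_nonneg (odeRhs_nonneg h1.le (hx.le.trans hm))]
    refine (odeRhs_anti h1.le hx hm).trans ?_
    have hx1 : x₀ ^ (1 - p t) ≤ B := rpow_le_max_rpow hx (abs_le.2 ⟨by linarith, by linarith⟩)
    have h3 : |f t| ^ p t / p t ≤ |f t| ^ p t := div_le_self (by positivity) h1.le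
    rw [odeRhs, mul_comm]
    gcongr
  have hlip : ∀ᵐ t ∂unitMeasure, ∀ a b : ℝ,
      |odeRhs p f (max a x₀) t - odeRhs p f (max b x₀) t| ≤
        |(|f t| ^ p t / p t * ((p t - 1) * x₀ ^ (-p t)))| * |a - b| := by
    filter_upwards [hp.one_lt] with t h1 a b
    have h0 : 0 < p t := by linarith
    have hder : ∀ s ∈ Ici x₀, HasDerivWithinAt (fun s : ℝ => s ^ (1 - p t))
        ((1 - p t) * s ^ (1 - p t - 1)) (Ici x₀) s := fun s hs =>
      (Real.hasDerivAt_rpow_const (Or.inl (hx.trans_le hs).ne')).hasDerivWithinAt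
    have hbd : ∀ s ∈ Ici x₀, ‖(1 - p t) * s ^ (1 - p t - 1)‖ ≤ (p t - 1) * x₀ ^ (-p t) := by
      intro s hs
      rw [norm_mul, Real.norm_of_nonpos (by linarith : 1 - p t ≤ 0),
        Real.norm_of_nonneg (Real.rpow_nonneg (hx.le.trans hs) _),
        show 1 - p t - 1 = -p t by ring, neg_sub]
      exact mul_le_mul_of_nonneg_left (Real.rpow_le_rpow_of_nonpos hx hs (by linarith))
        (by linarith)
    have hmvt := (convex_Ici x₀).norm_image_sub_le_of_norm_hasDerivWithin_le hder hbd
      (mem_Ici.2 (le_max_right b x₀)) (mem_Ici.2 (le_max_right a x₀))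
    rw [Real.norm_eq_abs, Real.norm_eq_abs] at hmvt
    have hg : 0 ≤ |f t| ^ p t / p t := by positivity
    have hc : 0 ≤ (p t - 1) * x₀ ^ (-p t) := mul_nonneg (by linarith) (by positivity)
    have hab : |max a x₀ - max b x₀| ≤ |a - b| := abs_max_sub_max_le_abs a b x₀
    rw [abs_of_nonneg (mul_nonneg hg hc)]
    simp only [odeRhs]
    rw [← mul_sub, abs_mul, abs_of_nonneg hg, mul_assoc]
    refine mul_le_mul_of_nonneg_left (hmvt.trans ?_) hg
    gcongr
  obtain ⟨φ, hφ0, hφ⟩ := exists_isPrimitive_of_lipschitz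
    (h := fun t s => odeRhs p f (max s x₀) t) hK (fun t => abs_nonneg _) hmeas hlip x₀
  have hge : ∀ t ∈ Icc (0 : ℝ) 1, x₀ ≤ φ t := fun t ht => by
    rw [← hφ0]
    refine hφ.mono ?_ le_rfl ht.1 ht.2
    filter_upwards [hp.one_lt] with t h1
    exact odeRhs_nonneg h1.le (hx.le.trans (le_max_right _ _))
  refine ⟨φ, isSolution_iff.2 ⟨hφ.congr_ae ?_, hφ0, fun t ht => hx.trans_le (hge t ht)⟩⟩
  filter_upwards [ae_mem_unit] with t ht
  rw [max_eq_left (hge t ht)]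

/-- Solutions lie below supersolutions with a larger initial value. -/
theorem IsSolution.le_supersolution (h : IsSolution p f x₀ φ) (hp : ∀ᵐ t ∂unitMeasure, 1 ≤ p t)
    (hψ : IsPrimitive ψ v) (hpos : ∀ t ∈ Icc (0 : ℝ) 1, 0 < ψ t)
    (hle : ∀ᵐ t ∂unitMeasure, odeRhs p f (ψ t) t ≤ v t) (h0 : x₀ ≤ ψ 0) :
    ∀ t ∈ Icc (0 : ℝ) 1, φ t ≤ ψ t := by
  obtain ⟨h1, h2, h3⟩ := isSolution_iff.1 h
  refine h1.le_of_deriv_le hψ (h2 ▸ h0) ?_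
  filter_upwards [hp, hle, ae_mem_unit] with t hpt hlt htm hc
  exact (odeRhs_anti hpt (hpos t htm) hc).trans hlt

theorem IsSolution.le_of_le {y₀ : ℝ} (h : IsSolution p f x₀ φ) (k : IsSolution p f y₀ ψ)
    (hp : ∀ᵐ t ∂unitMeasure, 1 ≤ p t) (h0 : x₀ ≤ y₀) : ∀ t ∈ Icc (0 : ℝ) 1, φ t ≤ ψ t := by
  obtain ⟨k1, k2, k3⟩ := isSolution_iff.1 k
  exact h.le_supersolution hp k1 k3 (Eventually.of_forall fun _ => le_rfl) (k2 ▸ h0)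

/-- The solutions depend non-expansively on the initial value, so their increments are bounded by
the norm. -/
theorem IsSolution.ofReal_sub_le_lpNorm (h : IsSolution p f x₀ φ) (hx : 0 < x₀)
    (hp : ∀ᵐ t ∂unitMeasure, 1 ≤ p t) : ENNReal.ofReal (φ 1 - x₀) ≤ lpNorm p f := by
  refine le_iInf₂ fun φ₀ ⟨Φ, hΦ, hlim⟩ => ENNReal.ofReal_le_ofReal ?_
  refine ge_of_tendsto (hlim 1 (by simp)) ?_
  filter_upwards [Ioo_mem_nhdsGT hx] with y hy
  have hle := (hΦ y hy.1).le_of_le h hp hy.2.le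
  obtain ⟨h1, h2, h3⟩ := isSolution_iff.1 h
  obtain ⟨k1, k2, k3⟩ := isSolution_iff.1 (hΦ y hy.1)
  have hint := integral_mono_ae h1.integrable k1.integrable (by
    filter_upwards [hp, ae_mem_unit] with t hpt htm
    exact odeRhs_anti hpt (k3 t htm) (hle t htm))
  rw [h1.integral_eq, k1.integral_eq, h2, k2] at hint
  linarith [hy.1]

/-- Functions of finite norm have solutions for all positive initial values. -/
theorem exists_isSolution_of_lpNorm_lt_top (hp : ∀ᵐ t ∂unitMeasure, 1 ≤ p t)
    (hN : lpNorm p f < ∞) (hx : 0 < x₀) :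
    ∃ φ, IsSolution p f x₀ φ ∧ φ 1 ≤ x₀ + (lpNorm p f).toReal := by
  have hN' := hN
  simp only [lpNorm, iInf_lt_iff] at hN'
  obtain ⟨_, ⟨Φ, hΦ, _⟩, _⟩ := hN'
  refine ⟨Φ x₀, hΦ x₀ hx, ?_⟩
  have h1 := (hΦ x₀ hx).ofReal_sub_le_lpNorm hx hp
  have h2 := (ENNReal.ofReal_le_iff_le_toReal hN.ne).1 h1
  linarith

theorem exists_isZeroPlusSolution (hp : IsBddExponent p) (hf : AEMeasurable f unitMeasure)
    (hint : Integrable (fun t => |f t| ^ p t) unitMeasure) :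
    ∃ φ, IsZeroPlusSolution p f φ := by
  have hp1 : ∀ᵐ t ∂unitMeasure, 1 ≤ p t := hp.one_lt.mono fun _ h => h.le
  choose! Φ hΦ using fun x (hx : 0 < x) => exists_isSolution hp hf hint hx
  refine ⟨fun t => sInf ((fun x => Φ x t) '' Ioo 0 1), Φ, hΦ, fun t ht => ?_⟩
  refine MonotoneOn.tendsto_nhdsWithin_Ioo_right (nonempty_Ioo.2 one_pos)
    (fun x hx y hy hxy => ?_) ⟨0, ?_⟩
  · exact (hΦ x hx.1).le_of_le (hΦ y hy.1) hp1 hxy t ht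
  · rintro _ ⟨x, hx, rfl⟩
    exact ((hΦ x hx.1).pos t ht).le

/-- The modular is finite if there is a positive supersolution. -/
theorem integrable_modular_of_supersolution (hp : IsBddExponent p)
    (hf : AEMeasurable f unitMeasure) (hψ : IsPrimitive ψ v)
    (hpos : ∀ t ∈ Icc (0 : ℝ) 1, 0 < ψ t)
    (hle : ∀ᵐ t ∂unitMeasure, odeRhs p f (ψ t) t ≤ v t) :
    Integrable (fun t => |f t| ^ p t) unitMeasure := by
  obtain ⟨R, hR1, hR⟩ := hp.exists_le
  obtain ⟨C, hC⟩ := isCompact_Icc.exists_bound_of_continuousOn hψ.continuousOn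
  set B := max C 1
  refine Integrable.mono' (hψ.integrable.const_mul (R * B ^ R))
    (aemeasurable_modular hp.aemeasurable hf).aestronglyMeasurable ?_
  filter_upwards [hp.one_lt, hR, hle, ae_mem_unit] with t h1 h2 h3 h4
  have hψt := hpos t h4
  have h0 : 0 < p t := by linarith
  have hψB : ψ t ≤ B := ((le_abs_self _).trans (hC t h4)).trans (le_max_left _ _)
  have hB : 1 ≤ B := le_max_right _ _
  have hpow : ψ t ^ (p t - 1) ≤ B ^ R :=
    (Real.rpow_le_rpow hψt.le hψB (by linarith)).trans
      (Real.rpow_le_rpow_of_exponent_le hB (by linarith))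
  rw [Real.norm_of_nonneg (by positivity)]
  have hrhs := odeRhs_nonneg (f := f) h1.le hψt.le
  rw [abs_rpow_eq_mul_odeRhs h0.ne' hψt]
  gcongr

/-- The norm is bounded by the endpoint value of any positive supersolution. -/
theorem lpNorm_le_of_supersolution (hp : IsBddExponent p) (hf : AEMeasurable f unitMeasure)
    (hψ : IsPrimitive ψ v) (hpos : ∀ t ∈ Icc (0 : ℝ) 1, 0 < ψ t)
    (hle : ∀ᵐ t ∂unitMeasure, odeRhs p f (ψ t) t ≤ v t) :
    lpNorm p f ≤ ENNReal.ofReal (ψ 1) := by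
  have hp1 : ∀ᵐ t ∂unitMeasure, 1 ≤ p t := hp.one_lt.mono fun _ h => h.le
  obtain ⟨φ, hφ⟩ := exists_isZeroPlusSolution hp hf
    (integrable_modular_of_supersolution hp hf hψ hpos hle)
  refine (iInf₂_le φ hφ).trans (ENNReal.ofReal_le_ofReal ?_)
  obtain ⟨Φ, hΦ, hlim⟩ := hφ
  refine le_of_tendsto (hlim 1 (by simp)) ?_
  filter_upwards [Ioo_mem_nhdsGT (hpos 0 (by simp))] with x hx
  exact (hΦ x hx.1).le_supersolution hp1 hψ hpos hle hx.2.le 1 (by simp)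

theorem integrable_modular_of_lpNorm_lt_top (hp : IsBddExponent p)
    (hf : AEMeasurable f unitMeasure) (hN : lpNorm p f < ∞) :
    Integrable (fun t => |f t| ^ p t) unitMeasure := by
  obtain ⟨φ, hφ, _⟩ := exists_isSolution_of_lpNorm_lt_top
    (hp.one_lt.mono fun _ h => h.le) hN one_pos
  obtain ⟨h1, _, h3⟩ := isSolution_iff.1 hφ
  exact integrable_modular_of_supersolution hp hf h1 h3 (Eventually.of_forall fun _ => le_rfl)

theorem le_ofReal_of_forall_pos_add {a : ℝ≥0∞} {M c : ℝ}
    (h : ∀ x : ℝ, 0 < x → a ≤ ENNReal.ofReal (M + c * x)) : a ≤ ENNReal.ofReal M := by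
  have h1 : Tendsto (fun x : ℝ => ENNReal.ofReal (M + c * x)) (𝓝[>] 0) (𝓝 (ENNReal.ofReal M)) := by
    have : Continuous fun x : ℝ => ENNReal.ofReal (M + c * x) :=
      ENNReal.continuous_ofReal.comp (by fun_prop)
    simpa using (this.tendsto 0).mono_left nhdsWithin_le_nhds
  exact ge_of_tendsto h1 (eventually_nhdsWithin_of_forall h)

/-! ### Norm axioms for bounded exponents -/

theorem lpNorm_add_le (hp : IsBddExponent p) (hf : AEMeasurable f unitMeasure)
    (hg : AEMeasurable g unitMeasure) :
    lpNorm p (fun t => f t + g t) ≤ lpNorm p f + lpNorm p g := by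
  have hp1 : ∀ᵐ t ∂unitMeasure, 1 ≤ p t := hp.one_lt.mono fun _ h => h.le
  rcases eq_or_ne (lpNorm p f) ∞ with h | hfN
  · simp [h]
  rcases eq_or_ne (lpNorm p g) ∞ with h | hgN
  · simp [h]
  rw [← ENNReal.ofReal_toReal hfN, ← ENNReal.ofReal_toReal hgN,
    ← ENNReal.ofReal_add ENNReal.toReal_nonneg ENNReal.toReal_nonneg]
  refine le_ofReal_of_forall_pos_add (c := 2) fun x hx => ?_
  obtain ⟨φ, hφ, hφ1⟩ := exists_isSolution_of_lpNorm_lt_top hp1 hfN.lt_top hx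
  obtain ⟨ψ, hψ, hψ1⟩ := exists_isSolution_of_lpNorm_lt_top hp1 hgN.lt_top hx
  obtain ⟨a1, _, a3⟩ := isSolution_iff.1 hφ
  obtain ⟨b1, _, b3⟩ := isSolution_iff.1 hψ
  refine (lpNorm_le_of_supersolution hp (hf.add hg) (a1.add b1)
    (fun t ht => add_pos (a3 t ht) (b3 t ht)) ?_).trans (ENNReal.ofReal_le_ofReal (by linarith))
  filter_upwards [hp1, ae_mem_unit] with t h1 h2
  exact odeRhs_add_le h1 (a3 t h2) (b3 t h2)

theorem lpNorm_mono (hp : IsBddExponent p) (hf : AEMeasurable f unitMeasure)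
    (h : ∀ᵐ t ∂unitMeasure, |f t| ≤ |g t|) : lpNorm p f ≤ lpNorm p g := by
  have hp1 : ∀ᵐ t ∂unitMeasure, 1 ≤ p t := hp.one_lt.mono fun _ h => h.le
  rcases eq_or_ne (lpNorm p g) ∞ with h | hgN
  · simp [h]
  rw [← ENNReal.ofReal_toReal hgN]
  refine le_ofReal_of_forall_pos_add (c := 1) fun x hx => ?_
  obtain ⟨ψ, hψ, hψ1⟩ := exists_isSolution_of_lpNorm_lt_top hp1 hgN.lt_top hx
  obtain ⟨b1, _, b3⟩ := isSolution_iff.1 hψ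
  refine (lpNorm_le_of_supersolution hp hf b1 b3 ?_).trans
    (ENNReal.ofReal_le_ofReal (by linarith))
  filter_upwards [hp1, ae_mem_unit, h] with t h1 h2 h3
  exact odeRhs_mono_abs h1 (b3 t h2) h3

theorem lpNorm_zero (hp : IsBddExponent p) : lpNorm p (fun _ => 0) = 0 := by
  refine le_antisymm ?_ zero_le
  rw [← ENNReal.ofReal_zero]
  refine le_ofReal_of_forall_pos_add (c := 1) fun x hx => ?_
  have h : IsPrimitive (fun _ => x) (fun _ => 0) := ⟨integrable_zero _ _ _, by simp⟩
  refine (lpNorm_le_of_supersolution hp aemeasurable_const h (fun _ _ => hx) ?_).trans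
    (ENNReal.ofReal_le_ofReal (by linarith))
  filter_upwards [hp.one_lt] with t h1
  exact (odeRhs_of_eq_zero (by linarith) rfl).le

theorem lpNorm_const_mul_le (hp : IsBddExponent p) (hf : AEMeasurable f unitMeasure) {c : ℝ}
    (hc : c ≠ 0) : lpNorm p (fun t => c * f t) ≤ ‖c‖ₑ * lpNorm p f := by
  have hp1 : ∀ᵐ t ∂unitMeasure, 1 ≤ p t := hp.one_lt.mono fun _ h => h.le
  have hc0 : 0 < |c| := abs_pos.2 hc
  rcases eq_or_ne (lpNorm p f) ∞ with h | hfN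
  · simp [h, hc]
  rw [← ENNReal.ofReal_toReal hfN, ← ofReal_norm, Real.norm_eq_abs,
    ← ENNReal.ofReal_mul hc0.le]
  refine le_ofReal_of_forall_pos_add (c := |c|) fun x hx => ?_
  obtain ⟨φ, hφ, hφ1⟩ := exists_isSolution_of_lpNorm_lt_top hp1 hfN.lt_top hx
  obtain ⟨a1, _, a3⟩ := isSolution_iff.1 hφ
  refine (lpNorm_le_of_supersolution hp (hf.const_mul c) (a1.const_mul |c|)
    (fun t ht => mul_pos hc0 (a3 t ht)) ?_).trans (ENNReal.ofReal_le_ofReal ?_)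
  · filter_upwards [ae_mem_unit] with t h2
    rw [odeRhs_eq (mul_pos hc0 (a3 t h2)), odeRhs_eq (a3 t h2), abs_mul,
      mul_div_mul_left _ _ hc0.ne']
    exact le_of_eq (by ring)
  · rw [← mul_add, add_comm]
    exact mul_le_mul_of_nonneg_left hφ1 hc0.le

theorem lpNorm_const_mul (hp : IsBddExponent p) (hf : AEMeasurable f unitMeasure) (c : ℝ) :
    lpNorm p (fun t => c * f t) = ‖c‖ₑ * lpNorm p f := by
  rcases eq_or_ne c 0 with rfl | hc
  · simpa using lpNorm_zero hp
  refine le_antisymm (lpNorm_const_mul_le hp hf hc) ?_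
  have h1 := lpNorm_const_mul_le hp (hf.const_mul c) (inv_ne_zero hc)
  simp only [inv_mul_cancel_left₀ hc] at h1
  calc ‖c‖ₑ * lpNorm p f ≤ ‖c‖ₑ * (‖c⁻¹‖ₑ * lpNorm p (fun t => c * f t)) := by gcongr
    _ = _ := by
      rw [← mul_assoc, ← enorm_mul, mul_inv_cancel₀ hc]
      simp

theorem ae_eq_zero_of_lpNorm_eq_zero (hp : IsBddExponent p) (h : lpNorm p f = 0) :
    f =ᵐ[unitMeasure] fun _ => 0 := by
  have hp1 : ∀ᵐ t ∂unitMeasure, 1 ≤ p t := hp.one_lt.mono fun _ h => h.le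
  obtain ⟨φ, hφ, hφ1⟩ := exists_isSolution_of_lpNorm_lt_top hp1 (h ▸ ENNReal.zero_lt_top) one_pos
  obtain ⟨a1, a2, a3⟩ := isSolution_iff.1 hφ
  have hnn : ∀ᵐ t ∂unitMeasure, 0 ≤ odeRhs p f (φ t) t := by
    filter_upwards [hp1, ae_mem_unit] with t h1 h2 using odeRhs_nonneg h1 (a3 t h2).le
  have hint : ∫ t, odeRhs p f (φ t) t ∂unitMeasure = 0 := by
    refine le_antisymm ?_ (integral_nonneg_of_ae hnn)
    rw [a1.integral_eq, a2]
    simp only [h, ENNReal.toReal_zero] at hφ1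
    linarith
  filter_upwards [(integral_eq_zero_iff_of_nonneg_ae hnn a1.integrable).1 hint, hp1,
    ae_mem_unit] with t h1 h2 h3
  have h4 : 0 < φ t ^ (1 - p t) := Real.rpow_pos_of_pos (a3 t h3) _
  have h5 : p t ≠ 0 := by linarith
  simp only [odeRhs, Pi.zero_apply, mul_eq_zero, div_eq_zero_iff, h4.ne', h5, or_false] at h1
  exact abs_eq_zero.1 ((Real.rpow_eq_zero (abs_nonneg _) h5).1 h1)

theorem isExtendedNorm_lpNorm (hp : IsBddExponent p) : IsExtendedNorm (lpNorm p) where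
  add_le f g := by
    rw [lpNorm_congr (AEEqFun.coeFn_add f g)]
    exact lpNorm_add_le hp f.aemeasurable g.aemeasurable
  smul c f := by
    rw [lpNorm_congr (AEEqFun.coeFn_smul c f)]
    exact lpNorm_const_mul hp f.aemeasurable c
  eq_zero f h := AEEqFun.ext ((ae_eq_zero_of_lpNorm_eq_zero hp h).trans AEEqFun.coeFn_zero.symm)

/-! ### Norm and modular -/

/-- The norm is small if the modular `∫ |f|ᵖ` is small. -/
theorem lpNorm_le_modular (hp : IsBddExponent p) (hf : AEMeasurable f unitMeasure) {R : ℝ}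
    (hR : ∀ᵐ t ∂unitMeasure, f t ≠ 0 → p t ≤ R)
    (hint : Integrable (fun t => |f t| ^ p t) unitMeasure) (hx : 0 < x₀) (hx1 : x₀ ≤ 1) :
    lpNorm p f ≤ ENNReal.ofReal (x₀ + x₀ ^ (1 - R) * ∫ t, |f t| ^ p t ∂unitMeasure) := by
  have hψ := IsPrimitive.of_integrable (hint.const_mul (x₀ ^ (1 - R))) x₀
  have hnn : ∀ t, 0 ≤ x₀ ^ (1 - R) * |f t| ^ p t := fun t => by positivity
  have hge : ∀ t ∈ Icc (0 : ℝ) 1, x₀ ≤ x₀ + ∫ s in (0 : ℝ)..t, x₀ ^ (1 - R) * |f s| ^ p s :=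
    fun t ht => by
      have := hψ.mono (Eventually.of_forall hnn) le_rfl ht.1 ht.2
      simpa using this
  refine (lpNorm_le_of_supersolution hp hf hψ (fun t ht => hx.trans_le (hge t ht)) ?_).trans
    (le_of_eq ?_)
  · filter_upwards [hp.one_lt, hR, ae_mem_unit] with t h1 h2 h3
    by_cases hft : f t = 0
    · rw [odeRhs_of_eq_zero (by linarith) hft]
      exact hnn t
    · refine (odeRhs_anti h1.le hx (hge t h3)).trans ?_
      have h4 : |f t| ^ p t / p t ≤ |f t| ^ p t := div_le_self (by positivity) h1.le
      have h5 : x₀ ^ (1 - p t) ≤ x₀ ^ (1 - R) :=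
        Real.rpow_le_rpow_of_exponent_ge hx hx1 (by linarith [h2 hft])
      rw [odeRhs, mul_comm]
      gcongr
  · rw [← integral_unitMeasure, integral_const_mul]

/-- The modular is bounded in terms of the norm. -/
theorem modular_le_of_lpNorm_le (hp : IsBddExponent p) (hf : AEMeasurable f unitMeasure) {R M : ℝ}
    (hR1 : 1 ≤ R) (hM : 0 ≤ M) (hR : ∀ᵐ t ∂unitMeasure, f t ≠ 0 → p t ≤ R)
    (hN : lpNorm p f ≤ ENNReal.ofReal M) :
    ∫ t, |f t| ^ p t ∂unitMeasure ≤ R * (1 + M) ^ (R - 1) * M := by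
  have hp1 : ∀ᵐ t ∂unitMeasure, 1 ≤ p t := hp.one_lt.mono fun _ h => h.le
  have hfin : lpNorm p f < ∞ := hN.trans_lt ENNReal.ofReal_lt_top
  obtain ⟨φ, hφ, hφ1⟩ := exists_isSolution_of_lpNorm_lt_top hp1 hfin one_pos
  obtain ⟨a1, a2, a3⟩ := isSolution_iff.1 hφ
  have hφM : φ 1 ≤ 1 + M := by
    have := ENNReal.toReal_le_of_le_ofReal hM hN
    linarith
  have hnn : ∀ᵐ t ∂unitMeasure, 0 ≤ odeRhs p f (φ t) t := by
    filter_upwards [hp1, ae_mem_unit] with t h1 h2 using odeRhs_nonneg h1 (a3 t h2).le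
  have h1 : ∫ t, |f t| ^ p t ∂unitMeasure ≤
      ∫ t, R * (1 + M) ^ (R - 1) * odeRhs p f (φ t) t ∂unitMeasure := by
    refine integral_mono_ae (integrable_modular_of_lpNorm_lt_top hp hf hfin)
      (a1.integrable.const_mul _) ?_
    filter_upwards [hp.one_lt, hR, ae_mem_unit, hnn] with t h1 h2 h3 h4
    have h0 : 0 < p t := by linarith
    by_cases hft : f t = 0
    · simp only [hft, abs_zero, Real.zero_rpow h0.ne']
      positivity
    · have hφt := a3 t h3
      have hle : φ t ≤ 1 + M := (a1.mono hnn h3.1 h3.2 le_rfl).trans hφM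
      have hpow : φ t ^ (p t - 1) ≤ (1 + M) ^ (R - 1) :=
        (Real.rpow_le_rpow hφt.le hle (by linarith)).trans
          (Real.rpow_le_rpow_of_exponent_le (by linarith) (by linarith [h2 hft]))
      have := h2 hft
      rw [abs_rpow_eq_mul_odeRhs h0.ne' hφt]
      gcongr
  refine h1.trans ?_
  rw [integral_const_mul, a1.integral_eq, a2]
  gcongr
  linarith

end OdeLp

namespace OdeLp

variable {p f g x φ ψ v : ℝ → ℝ} {x₀ : ℝ}

/-! ### Hölder's inequality and norming functions -/

theorem IsBddExponent.conj (hp : IsBddExponent p) : IsBddExponent (conj p) := by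
  obtain ⟨r, R, hr, h⟩ := hp.bdd
  refine ⟨hp.aemeasurable.div (hp.aemeasurable.sub_const 1), 1 + 1 / (max r R - 1),
    1 + 1 / (r - 1), ?_, ?_⟩
  · have : 0 < max r R - 1 := by linarith [le_max_left r R]
    have : 0 < 1 / (max r R - 1) := by positivity
    linarith
  · filter_upwards [h] with t ht
    have h1 : 0 < p t - 1 := by linarith
    have h2 : p t ≤ max r R := ht.2.trans (le_max_right _ _)
    have e : OdeLp.conj p t = 1 + 1 / (p t - 1) := by
      simp only [OdeLp.conj, Real.conjExponent]
      field_simp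
      ring
    rw [e]
    constructor
    · gcongr
    · gcongr
      exact ht.1

theorem holderConjugate_conj {t : ℝ} (h : 1 < p t) : (p t).HolderConjugate (conj p t) :=
  Real.HolderConjugate.conjExponent h

/-- Hölder's inequality: for solutions `φ` of the equation of `x` and `ψ` of the equation of `f`,
Young's inequality says that `(φψ)' ≥ |xf|`. -/
theorem integral_abs_mul_le (hp : IsBddExponent p) (hx : AEMeasurable x unitMeasure)
    (hf : AEMeasurable f unitMeasure) (hxN : lpNorm p x < ∞) (hfN : lpNorm (conj p) f < ∞) :
    Integrable (fun t => x t * f t) unitMeasure ∧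
      ∫ t, |x t * f t| ∂unitMeasure ≤ (lpNorm p x).toReal * (lpNorm (conj p) f).toReal := by
  have hp1 : ∀ᵐ t ∂unitMeasure, 1 ≤ p t := hp.one_lt.mono fun _ h => h.le
  have hq1 : ∀ᵐ t ∂unitMeasure, 1 ≤ conj p t := hp.conj.one_lt.mono fun _ h => h.le
  have key : ∀ ε : ℝ, 0 < ε → Integrable (fun t => x t * f t) unitMeasure ∧
      ∫ t, |x t * f t| ∂unitMeasure ≤
        (ε + (lpNorm p x).toReal) * (ε + (lpNorm (conj p) f).toReal) := by
    intro ε hε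
    obtain ⟨φ, hφ, hφ1⟩ := exists_isSolution_of_lpNorm_lt_top hp1 hxN hε
    obtain ⟨ψ, hψ, hψ1⟩ := exists_isSolution_of_lpNorm_lt_top hq1 hfN hε
    obtain ⟨a1, a2, a3⟩ := isSolution_iff.1 hφ
    obtain ⟨b1, b2, b3⟩ := isSolution_iff.1 hψ
    have hprod := a1.mul b1
    have hle : ∀ᵐ t ∂unitMeasure, |x t * f t| ≤
        odeRhs p x (φ t) t * ψ t + φ t * odeRhs (conj p) f (ψ t) t := by
      filter_upwards [hp.one_lt, ae_mem_unit] with t h1 h2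
      have hφt := a3 t h2
      have hψt := b3 t h2
      have hy := Real.young_inequality_of_nonneg (div_nonneg (abs_nonneg (x t)) hφt.le)
        (div_nonneg (abs_nonneg (f t)) hψt.le) (holderConjugate_conj h1)
      rw [odeRhs_eq hφt, odeRhs_eq hψt, abs_mul]
      calc |x t| * |f t| = φ t * ψ t * (|x t| / φ t * (|f t| / ψ t)) := by field_simp
        _ ≤ φ t * ψ t * ((|x t| / φ t) ^ p t / p t + (|f t| / ψ t) ^ conj p t / conj p t) := by
          gcongr
        _ = _ := by ring
    have hint : Integrable (fun t => x t * f t) unitMeasure :=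
      Integrable.mono' hprod.integrable (hx.mul hf).aestronglyMeasurable hle
    refine ⟨hint, (integral_mono_ae hint.abs hprod.integrable hle).trans ?_⟩
    rw [hprod.integral_eq, a2, b2]
    have h0 : 0 ≤ ε * ε := by positivity
    have := a3 1 (by simp)
    have := b3 1 (by simp)
    have : φ 1 * ψ 1 ≤ (ε + (lpNorm p x).toReal) * (ε + (lpNorm (conj p) f).toReal) := by
      gcongr
    linarith
  refine ⟨(key 1 one_pos).1, ?_⟩
  have hlim : Tendsto (fun ε : ℝ => (ε + (lpNorm p x).toReal) * (ε + (lpNorm (conj p) f).toReal))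
      (𝓝[>] 0) (𝓝 ((lpNorm p x).toReal * (lpNorm (conj p) f).toReal)) := by
    have : Continuous fun ε : ℝ =>
      (ε + (lpNorm p x).toReal) * (ε + (lpNorm (conj p) f).toReal) := by fun_prop
    simpa using (this.tendsto 0).mono_left nhdsWithin_le_nhds
  exact ge_of_tendsto hlim (eventually_nhdsWithin_of_forall fun ε hε => (key ε hε).2)

/-- Hölder's inequality is sharp. For a solution `ψ` of the equation of `f` and `b = |f| / ψ`, the
function `φ` with `φ' = φ bᵠ / p` solves the equation of `x = sgn f · bᵠ⁻¹ · φ`, where `q` is the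
conjugate exponent; there is equality in Young's inequality, so that `(φψ)' = xf`. -/
theorem exists_norming (hp : IsBddExponent p) (hf : AEMeasurable f unitMeasure)
    (hfN : lpNorm (conj p) f < ∞) {ε : ℝ} (hε : 0 < ε) :
    ∃ x : ℝ → ℝ, AEMeasurable x unitMeasure ∧ lpNorm p x ≤ 1 ∧
      (lpNorm (conj p) f).toReal - ε ≤ ∫ t, x t * f t ∂unitMeasure := by
  have hq1 : ∀ᵐ t ∂unitMeasure, 1 ≤ conj p t := hp.conj.one_lt.mono fun _ h => h.le
  obtain ⟨Q, hQ1, hQ⟩ := hp.conj.exists_le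
  obtain ⟨ψ, hψ, _⟩ := exists_isSolution_of_lpNorm_lt_top hq1 hfN hε
  obtain ⟨b1, b2, b3⟩ := isSolution_iff.1 hψ
  have hψmeas : AEMeasurable ψ unitMeasure :=
    (aestronglyMeasurable_of_continuousOn b1.continuousOn).aemeasurable
  have hψnn : ∀ᵐ t ∂unitMeasure, 0 ≤ odeRhs (conj p) f (ψ t) t := by
    filter_upwards [hq1, ae_mem_unit] with t h1 h2 using odeRhs_nonneg h1 (b3 t h2).le
  have hψge : ∀ t ∈ Icc (0 : ℝ) 1, ε ≤ ψ t := fun t ht => by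
    rw [← b2]; exact b1.mono hψnn le_rfl ht.1 ht.2
  set b : ℝ → ℝ := fun t => |f t| / ψ t
  have hbmeas : AEMeasurable b unitMeasure := hf.norm.div hψmeas
  set k : ℝ → ℝ := fun t => b t ^ conj p t / p t
  have hknn : ∀ᵐ t ∂unitMeasure, 0 ≤ k t := by
    filter_upwards [hp.one_lt, ae_mem_unit] with t h1 h2
    have := b3 t h2
    have h0 : 0 < p t := by linarith
    simp only [k, b]
    positivity
  have hkint : Integrable k unitMeasure := by
    refine Integrable.mono' (b1.integrable.const_mul (Q / ε))
      ((hbmeas.pow hp.conj.aemeasurable).div hp.aemeasurable).aestronglyMeasurable ?_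
    filter_upwards [hp.one_lt, hp.conj.one_lt, hQ, hknn, ae_mem_unit] with t h1 h2 h3 h4 h5
    have hψt := b3 t h5
    have hq0 : 0 < conj p t := by linarith
    have hbt : 0 ≤ b t := div_nonneg (abs_nonneg _) hψt.le
    rw [Real.norm_of_nonneg h4]
    have e : b t ^ conj p t = conj p t / ψ t * odeRhs (conj p) f (ψ t) t := by
      rw [odeRhs_eq hψt]; field_simp; rfl
    have hrhs : 0 ≤ odeRhs (conj p) f (ψ t) t := odeRhs_nonneg h2.le hψt.le
    calc k t ≤ b t ^ conj p t := div_le_self (by positivity) h1.le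
      _ ≤ _ := by
        rw [e]
        gcongr
        exact hψge t h5
  set W : ℝ → ℝ := fun T => 0 + ∫ t in (0 : ℝ)..T, k t
  have hW : IsPrimitive W k := IsPrimitive.of_integrable hkint 0
  have hW01 : W 0 ≤ W 1 := hW.mono hknn le_rfl zero_le_one le_rfl
  -- The normalization makes the endpoint value of the solution equal to one.
  set φ : ℝ → ℝ := fun t => Real.exp (W t + -W 1)
  have hφ : IsPrimitive φ (fun t => φ t * k t) := (hW.add_const (-W 1)).exp
  have hφpos : ∀ t, 0 < φ t := fun t => Real.exp_pos _
  have hφ1 : φ 1 = 1 := by simp [φ]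
  have hφ0 : φ 0 ≤ 1 := Real.exp_le_one_iff.2 (by linarith)
  have hφmeas : AEMeasurable φ unitMeasure :=
    (aestronglyMeasurable_of_continuousOn hφ.continuousOn).aemeasurable
  set x : ℝ → ℝ := fun t => f t / |f t| * b t ^ (conj p t - 1) * φ t
  have hxmeas : AEMeasurable x unitMeasure :=
    ((hf.div hf.norm).mul (hbmeas.pow (hp.conj.aemeasurable.sub_const 1))).mul hφmeas
  refine ⟨x, hxmeas, ?_, ?_⟩
  · have hle := lpNorm_le_of_supersolution hp hxmeas hφ (fun t _ => hφpos t) (by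
      filter_upwards [hp.one_lt, hknn, ae_mem_unit] with t h1 h2 h3
      by_cases hft : f t = 0
      · rw [odeRhs_of_eq_zero (by linarith) (by simp [x, hft])]
        exact mul_nonneg (hφpos t).le h2
      · have hψt := b3 t h3
        have hfa : 0 < |f t| := abs_pos.2 hft
        have hbt : 0 < b t := div_pos hfa hψt
        have hq := holderConjugate_conj h1
        have hxa : |x t| / φ t = b t ^ (conj p t - 1) := by
          simp only [x, abs_mul, abs_div, abs_abs, abs_of_pos (hφpos t), div_self hfa.ne', one_mul,
            abs_of_pos (Real.rpow_pos_of_pos hbt _), mul_div_cancel_right₀ _ (hφpos t).ne']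
        have hexp : (conj p t - 1) * p t = conj p t := by
          have h0 : p t - 1 ≠ 0 := by linarith
          simp only [conj, Real.conjExponent]
          field_simp
          ring
        rw [odeRhs_eq (hφpos t), hxa, ← Real.rpow_mul hbt.le, hexp, mul_div_assoc])
    simpa [hφ1] using hle
  · have hprod := hφ.mul b1
    have e : (fun t => φ t * k t * ψ t + φ t * odeRhs (conj p) f (ψ t) t) =ᵐ[unitMeasure]
        fun t => x t * f t := by
      filter_upwards [hp.one_lt, hp.conj.one_lt, ae_mem_unit] with t h1 h2 h3
      have hψt := b3 t h3
      have hq := holderConjugate_conj h1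
      rw [odeRhs_eq hψt]
      change φ t * (b t ^ conj p t / p t) * ψ t + φ t * (ψ t * b t ^ conj p t / conj p t) = _
      have e1 : φ t * (b t ^ conj p t / p t) * ψ t + φ t * (ψ t * b t ^ conj p t / conj p t)
          = φ t * ψ t * b t ^ conj p t := by
        have := hq.inv_add_inv_eq_one
        calc _ = φ t * ψ t * b t ^ conj p t * ((p t)⁻¹ + (conj p t)⁻¹) := by ring
          _ = _ := by rw [this, mul_one]
      rw [e1]
      by_cases hft : f t = 0
      · have hb0 : b t = 0 := by simp [b, hft]
        rw [hb0, Real.zero_rpow (by linarith), hft]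
        ring
      · have hfa : 0 < |f t| := abs_pos.2 hft
        have hbt : 0 < b t := div_pos hfa hψt
        have e2 : b t ^ conj p t = b t ^ (conj p t - 1) * (|f t| / ψ t) := by
          rw [Real.rpow_sub_one hbt.ne']
          exact (div_mul_cancel₀ _ hbt.ne').symm
        have e3 : f t / |f t| * f t = |f t| := by
          rw [div_mul_eq_mul_div, ← abs_mul_abs_self (f t), mul_div_assoc, div_self hfa.ne', mul_one]
        rw [e2]
        calc φ t * ψ t * (b t ^ (conj p t - 1) * (|f t| / ψ t))
            = |f t| * b t ^ (conj p t - 1) * φ t := by field_simp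
          _ = f t / |f t| * f t * b t ^ (conj p t - 1) * φ t := by rw [e3]
          _ = _ := by simp only [x]; ring
    rw [← integral_congr_ae e, hprod.integral_eq, b2, hφ1, one_mul]
    have h1 := lpNorm_le_of_supersolution hp.conj hf b1 b3 (Eventually.of_forall fun _ => le_rfl)
    have h2 := ENNReal.toReal_le_of_le_ofReal (b3 1 (by simp)).le h1
    have h3 : φ 0 * ε ≤ 1 * ε := by gcongr
    linarith

end OdeLp

namespace OdeLp

variable {p f g x : ℝ → ℝ} {M : ℝ}

/-! ### Bounded functionals for bounded exponents -/

/-- `f` is measurable with `‖f‖_{p(·)} < ∞`: membership in `L^{p(·)}` on the level of functions. -/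
def MemLpVar (p f : ℝ → ℝ) : Prop := AEMeasurable f unitMeasure ∧ lpNorm p f < ∞

/-- A norm smaller than `ε` is forced by a small modular, uniformly in all functions supported where
the exponent is at most `R`. -/
theorem exists_modular_le_imp_lpNorm_le (R : ℝ) {ε : ℝ} (hε : 0 < ε) :
    ∃ δ > 0, ∀ p f : ℝ → ℝ, IsBddExponent p → AEMeasurable f unitMeasure →
      (∀ᵐ t ∂unitMeasure, f t ≠ 0 → p t ≤ R) → Integrable (fun t => |f t| ^ p t) unitMeasure →
      ∫ t, |f t| ^ p t ∂unitMeasure ≤ δ → lpNorm p f ≤ ENNReal.ofReal ε := by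
  set y : ℝ := min (ε / 2) 1
  have hy : 0 < y := lt_min (by linarith) one_pos
  have hpow : 0 < y ^ (1 - R) := Real.rpow_pos_of_pos hy _
  refine ⟨ε / 2 / y ^ (1 - R), by positivity, fun p f hp hf hR hint hle => ?_⟩
  refine (lpNorm_le_modular hp hf hR hint hy (min_le_right _ _)).trans
    (ENNReal.ofReal_le_ofReal ?_)
  have h1 : y ^ (1 - R) * ∫ t, |f t| ^ p t ∂unitMeasure ≤ ε / 2 := by
    calc _ ≤ y ^ (1 - R) * (ε / 2 / y ^ (1 - R)) := by gcongr
      _ = ε / 2 := by field_simp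
  linarith [min_le_left (ε / 2) 1]

theorem lpNorm_lt_top_of_integrable (hp : IsBddExponent p) (hf : AEMeasurable f unitMeasure)
    (hint : Integrable (fun t => |f t| ^ p t) unitMeasure) : lpNorm p f < ∞ := by
  obtain ⟨R, _, hR⟩ := hp.exists_le
  exact (lpNorm_le_modular hp hf (hR.mono fun _ h _ => h) hint one_pos le_rfl).trans_lt
    ENNReal.ofReal_lt_top

theorem MemLpVar.integrable (hp : IsBddExponent p) (hf : MemLpVar p f) :
    Integrable (fun t => |f t| ^ p t) unitMeasure :=
  integrable_modular_of_lpNorm_lt_top hp hf.1 hf.2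

theorem MemLpVar.add (hp : IsBddExponent p) (hf : MemLpVar p f) (hg : MemLpVar p g) :
    MemLpVar p (fun t => f t + g t) :=
  ⟨hf.1.add hg.1, (lpNorm_add_le hp hf.1 hg.1).trans_lt (ENNReal.add_lt_top.2 ⟨hf.2, hg.2⟩)⟩

theorem MemLpVar.const_mul (hp : IsBddExponent p) (hf : MemLpVar p f) (c : ℝ) :
    MemLpVar p (fun t => c * f t) :=
  ⟨hf.1.const_mul c, by
    rw [lpNorm_const_mul hp hf.1]; exact ENNReal.mul_lt_top enorm_lt_top hf.2⟩

theorem MemLpVar.sub (hp : IsBddExponent p) (hf : MemLpVar p f) (hg : MemLpVar p g) :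
    MemLpVar p (fun t => f t - g t) := by
  simpa [sub_eq_add_neg] using hf.add hp (hg.const_mul hp (-1))

theorem MemLpVar.mono (hp : IsBddExponent p) (hg : MemLpVar p g) (hf : AEMeasurable f unitMeasure)
    (h : ∀ᵐ t ∂unitMeasure, |f t| ≤ |g t|) : MemLpVar p f :=
  ⟨hf, (lpNorm_mono hp hf h).trans_lt hg.2⟩

theorem MemLpVar.indicator (hp : IsBddExponent p) (hf : MemLpVar p f) {A : Set ℝ}
    (hA : MeasurableSet A) : MemLpVar p (A.indicator f) :=
  hf.mono hp (hf.1.indicator hA) (Eventually.of_forall fun t => by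
    simpa using norm_indicator_le_norm_self (s := A) f t)

theorem memLpVar_of_bdd (hp : IsBddExponent p) (hf : AEMeasurable f unitMeasure) {c : ℝ}
    (hc : ∀ᵐ t ∂unitMeasure, |f t| ≤ c) : MemLpVar p f := by
  obtain ⟨R, _, hR⟩ := hp.exists_le
  refine ⟨hf, lpNorm_lt_top_of_integrable hp hf ?_⟩
  refine Integrable.mono' (integrable_const (max c 1 ^ R))
    (aemeasurable_modular hp.aemeasurable hf).aestronglyMeasurable ?_
  filter_upwards [hc, hR, hp.one_lt] with t h1 h2 h3
  rw [Real.norm_of_nonneg (by positivity)]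
  exact (Real.rpow_le_rpow (abs_nonneg _) (h1.trans (le_max_left _ _)) (by linarith)).trans
    (Real.rpow_le_rpow_of_exponent_le (le_max_right _ _) h2)

theorem memLpVar_indicator_one (hp : IsBddExponent p) {A : Set ℝ} (hA : MeasurableSet A) :
    MemLpVar p (A.indicator 1) :=
  memLpVar_of_bdd hp (aemeasurable_one.indicator hA) (c := 1) (Eventually.of_forall fun t => by
    by_cases h : t ∈ A <;> simp [h])

/-- Dominated convergence in `L^{p(·)}`. -/
theorem tendsto_lpNorm_sub_of_dominated (hp : IsBddExponent p) {ι : Type*} {l : Filter ι}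
    [l.IsCountablyGenerated] {F : ι → ℝ → ℝ} (hF : ∀ i, AEMeasurable (F i) unitMeasure)
    (hg : MemLpVar p g) (hf : AEMeasurable f unitMeasure)
    (hle : ∀ i, ∀ᵐ t ∂unitMeasure, |F i t - f t| ≤ |g t|)
    (hlim : ∀ᵐ t ∂unitMeasure, Tendsto (fun i => F i t) l (𝓝 (f t))) :
    Tendsto (fun i => (lpNorm p (fun t => F i t - f t)).toReal) l (𝓝 0) := by
  obtain ⟨R, _, hR⟩ := hp.exists_le
  have hmeas : ∀ i, AEMeasurable (fun t => F i t - f t) unitMeasure := fun i => (hF i).sub hf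
  have hmem : ∀ i, MemLpVar p (fun t => F i t - f t) := fun i => hg.mono hp (hmeas i) (hle i)
  have h1 : Tendsto (fun i => ∫ t, |F i t - f t| ^ p t ∂unitMeasure) l (𝓝 0) := by
    have := tendsto_integral_filter_of_dominated_convergence (μ := unitMeasure) (l := l)
      (F := fun i t => |F i t - f t| ^ p t) (f := fun _ => 0) (fun t => |g t| ^ p t)
      (Eventually.of_forall fun i =>
        (aemeasurable_modular hp.aemeasurable (hmeas i)).aestronglyMeasurable)
      (Eventually.of_forall fun i => by
        filter_upwards [hle i, hp.one_lt] with t h2 h3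
        rw [Real.norm_of_nonneg (by positivity)]
        exact Real.rpow_le_rpow (abs_nonneg _) h2 (by linarith))
      (hg.integrable hp)
      (by
        filter_upwards [hlim, hp.one_lt] with t h2 h3
        have h4 : Tendsto (fun i => |F i t - f t|) l (𝓝 0) := by
          simpa using (h2.sub_const (f t)).abs
        have h5 := h4.rpow_const (p := p t) (Or.inr (by linarith))
        rwa [Real.zero_rpow (by linarith)] at h5)
    simpa using this
  rw [Metric.tendsto_nhds]
  intro ε hε
  obtain ⟨δ, hδ, hδ'⟩ := exists_modular_le_imp_lpNorm_le R (half_pos hε)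
  filter_upwards [h1.eventually_lt_const hδ] with i hi
  have h2 := hδ' p _ hp (hmeas i) (hR.mono fun _ h _ => h) ((hmem i).integrable hp) hi.le
  have h3 := ENNReal.toReal_le_of_le_ofReal (half_pos hε).le h2
  rw [Real.dist_eq, sub_zero, abs_of_nonneg ENNReal.toReal_nonneg]
  linarith

/-- `Λ` restricts to a linear functional on `L^{p(·)}` of norm at most `M`; its values at other
functions are arbitrary. -/
structure IsBddFunctional (p : ℝ → ℝ) (M : ℝ) (Λ : (ℝ → ℝ) → ℝ) : Prop where
  add : ∀ f g, MemLpVar p f → MemLpVar p g → Λ (fun t => f t + g t) = Λ f + Λ g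
  smul : ∀ (c : ℝ) f, MemLpVar p f → Λ (fun t => c * f t) = c * Λ f
  bound : ∀ f, MemLpVar p f → |Λ f| ≤ M * (lpNorm p f).toReal

namespace IsBddFunctional

variable {Λ : (ℝ → ℝ) → ℝ}

theorem sub (hΛ : IsBddFunctional p M Λ) (hp : IsBddExponent p) (hf : MemLpVar p f)
    (hg : MemLpVar p g) : Λ (fun t => f t - g t) = Λ f - Λ g := by
  have h1 := hΛ.add f (fun t => -1 * g t) hf (hg.const_mul hp (-1))
  rw [hΛ.smul _ g hg] at h1
  simp only [neg_one_mul, ← sub_eq_add_neg] at h1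
  exact h1

theorem congr (hΛ : IsBddFunctional p M Λ) (hp : IsBddExponent p) (hf : MemLpVar p f)
    (hg : MemLpVar p g) (hfg : f =ᵐ[unitMeasure] g) : Λ f = Λ g := by
  have h1 := hΛ.bound _ (hf.sub hp hg)
  have h2 : lpNorm p (fun t => f t - g t) = 0 := by
    rw [← lpNorm_zero hp]
    refine lpNorm_congr ?_
    filter_upwards [hfg] with t ht
    simp [ht]
  rw [h2, hΛ.sub hp hf hg] at h1
  simp only [ENNReal.toReal_zero, mul_zero, abs_nonpos_iff] at h1
  linarith

theorem tendsto (hΛ : IsBddFunctional p M Λ) (hp : IsBddExponent p) {ι : Type*} {l : Filter ι}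
    [l.IsCountablyGenerated] {F : ι → ℝ → ℝ} (hF : ∀ i, MemLpVar p (F i)) (hf : MemLpVar p f)
    (hg : MemLpVar p g) (hle : ∀ i, ∀ᵐ t ∂unitMeasure, |F i t - f t| ≤ |g t|)
    (hlim : ∀ᵐ t ∂unitMeasure, Tendsto (fun i => F i t) l (𝓝 (f t))) :
    Tendsto (fun i => Λ (F i)) l (𝓝 (Λ f)) := by
  have h1 := (tendsto_lpNorm_sub_of_dominated hp (fun i => (hF i).1) hg hf.1 hle hlim).const_mul M
  rw [mul_zero] at h1
  rw [tendsto_iff_dist_tendsto_zero]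
  refine squeeze_zero (fun _ => dist_nonneg) (fun i => ?_) h1
  rw [Real.dist_eq, ← hΛ.sub hp (hF i) hf]
  exact hΛ.bound _ ((hF i).sub hp hf)

/-- A bounded functional is determined by its values at indicator functions, as simple functions
are dense. -/
theorem eq_zero_of_indicator (hΛ : IsBddFunctional p M Λ) (hp : IsBddExponent p)
    (h0 : ∀ A, MeasurableSet A → Λ (A.indicator 1) = 0) (hf : MemLpVar p f) : Λ f = 0 := by
  have hsimple : ∀ s : SimpleFunc ℝ ℝ, MemLpVar p s ∧ Λ s = 0 := by
    intro s
    induction s using SimpleFunc.induction with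
    | const c hs =>
      rename_i A
      have e : (⇑(SimpleFunc.piecewise A hs (SimpleFunc.const ℝ c) (SimpleFunc.const ℝ 0)))
          = fun t => c * A.indicator 1 t := by
        funext t
        by_cases ht : t ∈ A <;> simp [ht]
      have hm := memLpVar_indicator_one hp hs
      rw [e, hΛ.smul _ _ hm, h0 _ hs]
      exact ⟨hm.const_mul hp c, mul_zero c⟩
    | @add s₁ s₂ _ h1 h2 =>
      have e : (⇑(s₁ + s₂)) = fun t => s₁ t + s₂ t := rfl
      rw [e, hΛ.add _ _ h1.1 h2.1, h1.2, h2.2]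
      exact ⟨h1.1.add hp h2.1, add_zero 0⟩
  set f' := hf.1.mk f
  have hf'm : Measurable f' := hf.1.measurable_mk
  have hff' : f =ᵐ[unitMeasure] f' := hf.1.ae_eq_mk
  have hf' : MemLpVar p f' := ⟨hf'm.aemeasurable, lpNorm_congr (p := p) hff' ▸ hf.2⟩
  rw [hΛ.congr hp hf hf' hff']
  have hlim := hΛ.tendsto hp (l := atTop)
    (F := fun n => SimpleFunc.approxOn f' hf'm univ 0 (mem_univ _) n)
    (fun n => (hsimple _).1) hf' (hf'.const_mul hp 3)
    (fun n => Eventually.of_forall fun t => by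
      have h1 := SimpleFunc.norm_approxOn_zero_le hf'm (mem_univ (0 : ℝ)) t n
      simp only [Real.norm_eq_abs] at h1
      rw [abs_mul, abs_of_pos (by norm_num : (0 : ℝ) < 3)]
      exact (abs_sub _ _).trans (by linarith))
    (Eventually.of_forall fun t => SimpleFunc.tendsto_approxOn hf'm (mem_univ _) (by simp))
  simp only [(hsimple _).2] at hlim
  exact tendsto_nhds_unique hlim tendsto_const_nhds

/-- Integration against an element of the dual space is a bounded functional. -/
theorem integral_mul (hp : IsBddExponent p) (hg : MemLpVar (conj p) g) :
    IsBddFunctional p (lpNorm (conj p) g).toReal (fun x => ∫ t, x t * g t ∂unitMeasure) where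
  add f f' hf hf' := by
    have h1 := (integral_abs_mul_le hp hf.1 hg.1 hf.2 hg.2).1
    have h2 := (integral_abs_mul_le hp hf'.1 hg.1 hf'.2 hg.2).1
    rw [← integral_add h1 h2]
    simp only [add_mul]
  smul c f _ := by
    rw [← integral_const_mul]
    simp only [mul_assoc]
  bound f hf := by
    rw [mul_comm]
    exact abs_integral_le_integral_abs.trans (integral_abs_mul_le hp hf.1 hg.1 hf.2 hg.2).2

theorem sub_functional {M' : ℝ} {Λ' : (ℝ → ℝ) → ℝ} (hΛ : IsBddFunctional p M Λ)
    (hΛ' : IsBddFunctional p M' Λ') : IsBddFunctional p (M + M') (fun x => Λ x - Λ' x) where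
  add f g hf hg := by rw [hΛ.add f g hf hg, hΛ'.add f g hf hg]; ring
  smul c f hf := by rw [hΛ.smul c f hf, hΛ'.smul c f hf]; ring
  bound f hf := by
    have h1 := hΛ.bound f hf
    have h2 := hΛ'.bound f hf
    refine (abs_sub _ _).trans ?_
    rw [add_mul]
    exact add_le_add h1 h2

theorem eq_integral_of_indicator (hΛ : IsBddFunctional p M Λ) (hp : IsBddExponent p)
    (hg : MemLpVar (conj p) g)
    (h : ∀ A, MeasurableSet A → Λ (A.indicator 1) = ∫ t in A, g t ∂unitMeasure)
    (hx : MemLpVar p x) : Λ x = ∫ t, x t * g t ∂unitMeasure := by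
  have h1 := (hΛ.sub_functional (integral_mul hp hg)).eq_zero_of_indicator hp (fun A hA => by
    rw [h A hA, ← integral_indicator hA, sub_eq_zero]
    refine integral_congr_ae (Eventually.of_forall fun t => ?_)
    by_cases ht : t ∈ A <;> simp [ht]) hx
  linarith

theorem indicator (hΛ : IsBddFunctional p M Λ) (hp : IsBddExponent p) (hM : 0 ≤ M) {B : Set ℝ}
    (hB : MeasurableSet B) : IsBddFunctional p M (fun x => Λ (B.indicator x)) where
  add f g hf hg := by
    rw [← hΛ.add _ _ (hf.indicator hp hB) (hg.indicator hp hB)]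
    congr 1
    funext t
    by_cases ht : t ∈ B <;> simp [ht]
  smul c f hf := by
    rw [← hΛ.smul _ _ (hf.indicator hp hB)]
    congr 1
    funext t
    by_cases ht : t ∈ B <;> simp [ht]
  bound f hf := by
    refine (hΛ.bound _ (hf.indicator hp hB)).trans (mul_le_mul_of_nonneg_left ?_ hM)
    refine ENNReal.toReal_mono hf.2.ne (lpNorm_mono hp (hf.1.indicator hB) ?_)
    exact Eventually.of_forall fun t => by
      simpa using norm_indicator_le_norm_self (s := B) f t

/-- As Hölder's inequality is sharp, a function representing a functional has norm at most that of the
functional. -/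
theorem lpNorm_le_of_eq_integral (hΛ : IsBddFunctional p M Λ) (hp : IsBddExponent p) (hM : 0 ≤ M)
    (hg : MemLpVar (conj p) g) (h : ∀ x, MemLpVar p x → Λ x = ∫ t, x t * g t ∂unitMeasure) :
    lpNorm (conj p) g ≤ ENNReal.ofReal M := by
  rw [ENNReal.le_ofReal_iff_toReal_le hg.2.ne hM]
  refine le_of_forall_pos_le_add fun ε hε => ?_
  obtain ⟨x, hx, hx1, hxg⟩ := exists_norming hp hg.1 hg.2 hε
  have hxm : MemLpVar p x := ⟨hx, hx1.trans_lt ENNReal.one_lt_top⟩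
  have h1 := hΛ.bound x hxm
  have h2 : (lpNorm p x).toReal ≤ 1 := by
    simpa using ENNReal.toReal_mono ENNReal.one_ne_top hx1
  have h3 : M * (lpNorm p x).toReal ≤ M * 1 := by gcongr
  rw [h x hxm] at h1
  linarith [le_abs_self (∫ t, x t * g t ∂unitMeasure)]

/-- The set function `A ↦ Λ 1_A` is a signed measure with an integrable density. -/
theorem exists_density (hΛ : IsBddFunctional p M Λ) (hp : IsBddExponent p) :
    ∃ g : ℝ → ℝ, Integrable g unitMeasure ∧
      ∀ A, MeasurableSet A → Λ (A.indicator 1) = ∫ t in A, g t ∂unitMeasure := by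
  classical
  have hempty : Λ ((∅ : Set ℝ).indicator 1) = 0 := by
    have h := hΛ.smul 0 (fun _ => 0) (memLpVar_of_bdd hp aemeasurable_const (c := 0) (by simp))
    simp only [zero_mul] at h
    simpa using h
  have hsum : ∀ (A : ℕ → Set ℝ), (∀ i, MeasurableSet (A i)) → Pairwise (Function.onFun Disjoint A) →
      ∀ s : Finset ℕ, ∑ i ∈ s, Λ ((A i).indicator 1) = Λ ((⋃ i ∈ s, A i).indicator 1) := by
    intro A hA hd s
    induction s using Finset.induction_on with
    | empty => simpa using hempty.symm
    | insert j s hj ih =>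
      rw [Finset.sum_insert hj, ih, ← hΛ.add _ _ (memLpVar_indicator_one hp (hA j))
        (memLpVar_indicator_one hp (s.measurableSet_biUnion fun i _ => hA i))]
      congr 1
      have hdis : Disjoint (A j) (⋃ i ∈ s, A i) := by
        rw [disjoint_iUnion₂_right]
        intro i hi
        exact hd (fun h => hj (h ▸ hi))
      rw [Finset.set_biUnion_insert, indicator_union_of_disjoint hdis]
  let ν : SignedMeasure ℝ :=
    { measureOf' := fun A => if MeasurableSet A then Λ (A.indicator 1) else 0
      empty' := by rw [if_pos MeasurableSet.empty, hempty]
      not_measurable' := fun A hA => if_neg hA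
      m_iUnion' := by
        intro A hA hd
        simp only [hA, MeasurableSet.iUnion hA, if_true]
        rw [HasSum, SummationFilter.unconditional_filter]
        simp only [hsum A hA hd]
        refine hΛ.tendsto hp (fun s => memLpVar_indicator_one hp
          (s.measurableSet_biUnion fun i _ => hA i))
          (memLpVar_indicator_one hp (MeasurableSet.iUnion hA))
          (memLpVar_of_bdd hp (f := fun _ => 1) aemeasurable_const (c := 1) (by simp))
          (fun s => Eventually.of_forall fun t => ?_) (Eventually.of_forall fun t => ?_)
        · by_cases h1 : t ∈ ⋃ i ∈ s, A i <;> by_cases h2 : t ∈ ⋃ i, A i <;> simp [h1, h2]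
        · refine tendsto_const_nhds.congr' ?_
          by_cases h2 : t ∈ ⋃ i, A i
          · obtain ⟨i, hi⟩ := mem_iUnion.1 h2
            filter_upwards [eventually_ge_atTop ({i} : Finset ℕ)] with s hs
            have h1 : t ∈ ⋃ i ∈ s, A i := mem_iUnion₂.2 ⟨i, hs (by simp), hi⟩
            rw [indicator_of_mem h1, indicator_of_mem h2]
          · filter_upwards with s
            have h1 : t ∉ ⋃ i ∈ s, A i := fun h => h2 (iUnion₂_subset_iUnion _ _ h)
            rw [indicator_of_notMem h1, indicator_of_notMem h2] }
  have hν : ∀ A, MeasurableSet A → ν A = Λ (A.indicator 1) := fun A hA => if_pos hA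
  have hac : ν ≪ᵥ unitMeasure.toENNRealVectorMeasure := by
    refine VectorMeasure.AbsolutelyContinuous.mk fun A hA h0 => ?_
    rw [Measure.toENNRealVectorMeasure_apply_measurable hA] at h0
    rw [hν A hA, ← hempty]
    refine hΛ.congr hp (memLpVar_indicator_one hp hA)
      (memLpVar_indicator_one hp MeasurableSet.empty) ?_
    rw [indicator_empty]
    exact indicator_meas_zero h0
  refine ⟨ν.rnDeriv unitMeasure, SignedMeasure.integrable_rnDeriv ν unitMeasure,
    fun A hA => ?_⟩
  rw [← hν A hA, ← withDensityᵥ_apply (SignedMeasure.integrable_rnDeriv ν unitMeasure) hA,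
    SignedMeasure.withDensityᵥ_rnDeriv_eq ν unitMeasure hac]

/-- Riesz representation for bounded exponents. The truncations of the density have norm at most `M`
because Hölder's inequality is sharp, so the density lies in the dual space by Fatou's lemma. -/
theorem exists_eq_integral (hΛ : IsBddFunctional p M Λ) (hp : IsBddExponent p) (hM : 0 ≤ M) :
    ∃ g : ℝ → ℝ, AEMeasurable g unitMeasure ∧ lpNorm (conj p) g ≤ ENNReal.ofReal M ∧
      ∀ x, MemLpVar p x → Λ x = ∫ t, x t * g t ∂unitMeasure := by
  obtain ⟨g₀, hg₀, hden₀⟩ := hΛ.exists_density hp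
  set g := hg₀.1.aemeasurable.mk g₀
  have hgm : Measurable g := hg₀.1.aemeasurable.measurable_mk
  have hgg : g₀ =ᵐ[unitMeasure] g := hg₀.1.aemeasurable.ae_eq_mk
  have hden : ∀ A, MeasurableSet A → Λ (A.indicator 1) = ∫ t in A, g t ∂unitMeasure :=
    fun A hA => by rw [hden₀ A hA]; exact setIntegral_congr_ae hA (hgg.mono fun _ h _ => h)
  let B : ℕ → Set ℝ := fun n => {t | |g t| ≤ n}
  have hB : ∀ n, MeasurableSet (B n) := fun n => measurableSet_le hgm.abs measurable_const
  have htrunc : ∀ n, MemLpVar (conj p) ((B n).indicator g) := fun n =>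
    memLpVar_of_bdd hp.conj (hgm.indicator (hB n)).aemeasurable (c := n)
      (Eventually.of_forall fun t => by
        by_cases ht : t ∈ B n
        · rw [indicator_of_mem ht]
          exact ht
        · simp [ht])
  have hbound : ∀ n, lpNorm (conj p) ((B n).indicator g) ≤ ENNReal.ofReal M := by
    intro n
    have hΛn := hΛ.indicator hp hM (hB n)
    refine hΛn.lpNorm_le_of_eq_integral hp hM (htrunc n) fun x hx => ?_
    refine hΛn.eq_integral_of_indicator hp (htrunc n) (fun A hA => ?_) hx
    rw [indicator_indicator, hden _ ((hB n).inter hA), setIntegral_indicator (hB n), inter_comm]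
  obtain ⟨R, hR1, hR⟩ := hp.conj.exists_le
  have hint : Integrable (fun t => |g t| ^ conj p t) unitMeasure := by
    refine integrable_of_tendsto (G := fun n t => |(B n).indicator g t| ^ conj p t) ?_
      (fun n => (aemeasurable_modular hp.conj.aemeasurable (htrunc n).1).aestronglyMeasurable) ?_
    · refine Eventually.of_forall fun t => tendsto_const_nhds.congr' ?_
      obtain ⟨N, hN⟩ := exists_nat_ge |g t|
      filter_upwards [eventually_ge_atTop N] with n hn
      have : t ∈ B n := hN.trans (Nat.cast_le.2 hn)
      rw [indicator_of_mem this]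
    · refine ne_top_of_le_ne_top (ENNReal.ofReal_ne_top (r := R * (1 + M) ^ (R - 1) * M))
        (liminf_le_of_le (by isBoundedDefault) fun b hb => ?_)
      obtain ⟨n, hn⟩ := hb.exists
      refine hn.trans ?_
      have h1 := modular_le_of_lpNorm_le hp.conj (htrunc n).1 hR1 hM
        (hR.mono fun _ h _ => h) (hbound n)
      rw [← ofReal_integral_norm_eq_lintegral_enorm ((htrunc n).integrable hp.conj)]
      refine ENNReal.ofReal_le_ofReal (le_trans (le_of_eq ?_) h1)
      refine integral_congr_ae (Eventually.of_forall fun t => ?_)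
      exact Real.norm_of_nonneg (by positivity)
  have hgmem : MemLpVar (conj p) g :=
    ⟨hgm.aemeasurable, lpNorm_lt_top_of_integrable hp.conj hgm.aemeasurable hint⟩
  have hrep : ∀ x, MemLpVar p x → Λ x = ∫ t, x t * g t ∂unitMeasure := fun x hx =>
    hΛ.eq_integral_of_indicator hp hgmem hden hx
  exact ⟨g, hgm.aemeasurable, hΛ.lpNorm_le_of_eq_integral hp hM hgmem hrep, hrep⟩

end IsBddFunctional

end OdeLp

namespace OdeLp

variable {p f g x : ℝ → ℝ}

/-! ### The dual space -/

/-- The class in `L⁰` of a measurable function. -/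
noncomputable def mkL0 (f : ℝ → ℝ) (hf : AEMeasurable f unitMeasure) : L0 :=
  AEEqFun.mk f hf.aestronglyMeasurable

theorem coeFn_mkL0 (hf : AEMeasurable f unitMeasure) : mkL0 f hf =ᵐ[unitMeasure] f :=
  AEEqFun.coeFn_mk _ _

theorem mkL0_eq_iff (hf : AEMeasurable f unitMeasure) {u : L0} :
    mkL0 f hf = u ↔ f =ᵐ[unitMeasure] u :=
  ⟨fun h => h ▸ (coeFn_mkL0 hf).symm, fun h => AEEqFun.ext ((coeFn_mkL0 hf).trans h)⟩

section
variable {N : (ℝ → ℝ) → ℝ≥0∞} {h : IsExtendedNorm N}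

theorem FiniteSpace.norm_eq (f : FiniteSpace h) : ‖f‖ = (N f.toL0).toReal := rfl

theorem FiniteSpace.lt_top (f : FiniteSpace h) : N f.toL0 < ∞ := Subtype.property f

theorem FiniteSpace.ext {f g : FiniteSpace h} (hfg : f.toL0 = g.toL0) : f = g := Subtype.ext hfg

/-- The element of the normed space given by a class in `L⁰` of finite norm. -/
def FiniteSpace.mk (h : IsExtendedNorm N) (f : L0) (hf : N f < ∞) : FiniteSpace h := ⟨f, hf⟩

theorem FiniteSpace.toL0_mk (f : L0) (hf : N f < ∞) : (FiniteSpace.mk h f hf).toL0 = f := rfl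

theorem FiniteSpace.toL0_add (f g : FiniteSpace h) : (f + g).toL0 = f.toL0 + g.toL0 := rfl

theorem FiniteSpace.toL0_smul (c : ℝ) (f : FiniteSpace h) : (c • f).toL0 = c • f.toL0 := rfl

theorem FiniteSpace.coeFn_add (f g : FiniteSpace h) :
    (f + g).toL0 =ᵐ[unitMeasure] fun t => f.toL0 t + g.toL0 t :=
  AEEqFun.coeFn_add f.toL0 g.toL0

theorem FiniteSpace.coeFn_smul (c : ℝ) (f : FiniteSpace h) :
    (c • f).toL0 =ᵐ[unitMeasure] fun t => c * f.toL0 t :=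
  AEEqFun.coeFn_smul c f.toL0

end

/-- If Hölder's inequality holds between `V` and the space `FiniteSpace hq`, if it is sharp, and if
every functional on `V` is represented by a function of finite norm, then representation is an
isometric isomorphism of the dual space of `V` onto `FiniteSpace hq`. -/
theorem exists_dual_equiv {V : Type} [NormedAddCommGroup V] [NormedSpace ℝ V] {ι : V → L0}
    (hadd : ∀ x y, ι (x + y) = ι x + ι y) (hsmul : ∀ (c : ℝ) x, ι (c • x) = c • ι x)
    {N : (ℝ → ℝ) → ℝ≥0∞} (hq : IsExtendedNorm N)
    (hHolder : ∀ (x : V) (f : FiniteSpace hq),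
      Integrable (fun t => ι x t * f.toL0 t) unitMeasure ∧
        |∫ t, ι x t * f.toL0 t ∂unitMeasure| ≤ ‖f‖ * ‖x‖)
    (hsharp : ∀ (f : FiniteSpace hq) (ε : ℝ), 0 < ε →
      ∃ x : V, ‖x‖ ≤ 1 ∧ ‖f‖ - ε ≤ ∫ t, ι x t * f.toL0 t ∂unitMeasure)
    (hrep : ∀ F : StrongDual ℝ V, ∃ f : FiniteSpace hq,
      ∀ x, F x = ∫ t, ι x t * f.toL0 t ∂unitMeasure) :
    ∃ e : StrongDual ℝ V ≃L[ℝ] FiniteSpace hq, ∀ F : StrongDual ℝ V,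
      Represents ι F (e F).toL0 ∧ ‖F‖ = ‖e F‖ := by
  let T₀ : FiniteSpace hq → StrongDual ℝ V := fun f =>
    LinearMap.mkContinuous
      { toFun := fun x => ∫ t, ι x t * f.toL0 t ∂unitMeasure
        map_add' := fun x y => by
          rw [← integral_add (hHolder x f).1 (hHolder y f).1, hadd]
          refine integral_congr_ae ?_
          filter_upwards [AEEqFun.coeFn_add (ι x) (ι y)] with t ht
          rw [ht, Pi.add_apply, add_mul]
        map_smul' := fun c x => by
          rw [RingHom.id_apply, smul_eq_mul, ← integral_const_mul, hsmul]
          refine integral_congr_ae ?_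
          filter_upwards [AEEqFun.coeFn_smul c (ι x)] with t ht
          rw [ht, Pi.smul_apply, smul_eq_mul, mul_assoc] }
      ‖f‖ (fun x => (hHolder x f).2)
  have hT₀ : ∀ f x, T₀ f x = ∫ t, ι x t * f.toL0 t ∂unitMeasure := fun _ _ => rfl
  let T : FiniteSpace hq →ₗᵢ[ℝ] StrongDual ℝ V :=
    { toFun := T₀
      map_add' := fun f g => by
        ext x
        rw [add_apply, hT₀, hT₀, hT₀,
          ← integral_add (hHolder x f).1 (hHolder x g).1]
        refine integral_congr_ae ?_
        filter_upwards [FiniteSpace.coeFn_add f g] with t ht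
        rw [ht, mul_add]
      map_smul' := fun c f => by
        ext x
        rw [RingHom.id_apply, smul_apply, hT₀, hT₀, smul_eq_mul,
          ← integral_const_mul]
        refine integral_congr_ae ?_
        filter_upwards [FiniteSpace.coeFn_smul c f] with t ht
        rw [ht]
        ring
      norm_map' := fun f => by
        change ‖T₀ f‖ = ‖f‖
        refine le_antisymm (LinearMap.mkContinuous_norm_le _ (norm_nonneg f) _) ?_
        refine le_of_forall_pos_le_add fun ε hε => ?_
        obtain ⟨x, hx, hxf⟩ := hsharp f ε hε
        have h1 := (T₀ f).le_opNorm x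
        have h2 : ‖T₀ f‖ * ‖x‖ ≤ ‖T₀ f‖ * 1 := by gcongr
        rw [hT₀, Real.norm_eq_abs] at h1
        linarith [le_abs_self (∫ t, ι x t * f.toL0 t ∂unitMeasure)] }
  have hsurj : Function.Surjective T := fun F => by
    obtain ⟨f, hf⟩ := hrep F
    exact ⟨f, by ext x; exact (hf x).symm⟩
  let E := LinearIsometryEquiv.ofSurjective T hsurj
  refine ⟨E.symm.toContinuousLinearEquiv, fun F => ⟨fun x => ?_, (E.symm.norm_map F).symm⟩⟩
  refine ⟨(hHolder x _).1, ?_⟩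
  have : E (E.symm F) = F := E.apply_symm_apply F
  conv_lhs => rw [← this]
  rfl

theorem exists_dual_equiv_lpNorm (hp : IsBddExponent p) :
    ∃ e : StrongDual ℝ (FiniteSpace (isExtendedNorm_lpNorm hp)) ≃L[ℝ]
        FiniteSpace (isExtendedNorm_lpNorm hp.conj),
      ∀ F, Represents (fun x => x.toL0) F (e F).toL0 ∧ ‖F‖ = ‖e F‖ := by
  classical
  have hmem : ∀ x : FiniteSpace (isExtendedNorm_lpNorm hp), MemLpVar p x.toL0 := fun x =>
    ⟨x.toL0.aemeasurable, x.lt_top⟩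
  have hmk : ∀ {g : ℝ → ℝ} {p : ℝ → ℝ} (hg : MemLpVar p g), lpNorm p (mkL0 g hg.1) < ∞ :=
    fun hg => (lpNorm_congr (coeFn_mkL0 hg.1)).trans_lt hg.2
  refine exists_dual_equiv FiniteSpace.toL0_add FiniteSpace.toL0_smul _ (fun x f => ?_)
    (fun f ε hε => ?_) fun F => ?_
  · have h1 := integral_abs_mul_le hp x.toL0.aemeasurable f.toL0.aemeasurable x.lt_top f.lt_top
    refine ⟨h1.1, abs_integral_le_integral_abs.trans (h1.2.trans (le_of_eq ?_))⟩
    rw [mul_comm]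
    rfl
  · obtain ⟨x, hx, hx1, hxf⟩ := exists_norming hp f.toL0.aemeasurable f.lt_top hε
    have hxm : MemLpVar p x := ⟨hx, hx1.trans_lt ENNReal.one_lt_top⟩
    refine ⟨FiniteSpace.mk _ (mkL0 x hx) (hmk hxm), ?_, ?_⟩
    · rw [FiniteSpace.norm_eq, FiniteSpace.toL0_mk, lpNorm_congr (coeFn_mkL0 hx)]
      simpa using ENNReal.toReal_mono ENNReal.one_ne_top hx1
    · refine hxf.trans (le_of_eq (integral_congr_ae ?_))
      filter_upwards [coeFn_mkL0 hx] with t ht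
      rw [FiniteSpace.toL0_mk, ht]
  · let Λ : (ℝ → ℝ) → ℝ := fun g =>
      if hg : MemLpVar p g then F (FiniteSpace.mk _ (mkL0 g hg.1) (hmk hg)) else 0
    have hΛ : ∀ {g} (hg : MemLpVar p g), Λ g = F (FiniteSpace.mk _ (mkL0 g hg.1) (hmk hg)) :=
      fun hg => dif_pos hg
    have hbdd : IsBddFunctional p ‖F‖ Λ :=
      { add := fun f g hf hg => by
          rw [hΛ hf, hΛ hg, hΛ (hf.add hp hg), ← map_add]
          congr 1
        smul := fun c f hf => by
          rw [hΛ hf, hΛ (hf.const_mul hp c), ← smul_eq_mul, ← map_smul]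
          congr 1
        bound := fun f hf => by
          rw [hΛ hf]
          refine (F.le_opNorm _).trans (le_of_eq ?_)
          rw [FiniteSpace.norm_eq, FiniteSpace.toL0_mk, lpNorm_congr (coeFn_mkL0 hf.1)] }
    obtain ⟨g, hg, hgN, hrep⟩ := hbdd.exists_eq_integral hp (norm_nonneg F)
    have hgm : MemLpVar (conj p) g := ⟨hg, hgN.trans_lt ENNReal.ofReal_lt_top⟩
    refine ⟨FiniteSpace.mk _ (mkL0 g hg) (hmk hgm), fun x => ?_⟩
    have h1 : F x = Λ x.toL0 := by
      rw [hΛ (hmem x)]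
      congr 1
      exact FiniteSpace.ext ((mkL0_eq_iff x.toL0.aemeasurable).2 (ae_eq_refl _)).symm
    rw [h1, hrep _ (hmem x)]
    refine integral_congr_ae ?_
    filter_upwards [coeFn_mkL0 hg] with t ht
    rw [FiniteSpace.toL0_mk, ht]

/-- Essential bounds in the extended reals give a bounded exponent. -/
theorem IsBddExponent.of_essInf_essSup (hp : AEMeasurable p unitMeasure)
    (h1 : 1 < essInf (fun t => (p t : EReal)) unitMeasure)
    (h2 : essSup (fun t => (p t : EReal)) unitMeasure < ⊤) : IsBddExponent p := by
  obtain ⟨r, hr1, hr⟩ := EReal.lt_iff_exists_real_btwn.1 h1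
  obtain ⟨R, hR, _⟩ := EReal.lt_iff_exists_real_btwn.1 h2
  refine ⟨hp, r, R, by exact_mod_cast hr1, ?_⟩
  filter_upwards [ae_essInf_le (f := fun t => (p t : EReal)) (μ := unitMeasure),
    ae_le_essSup (f := fun t => (p t : EReal)) (μ := unitMeasure)] with t h3 h4
  exact ⟨EReal.coe_le_coe_iff.1 (hr.le.trans h3), EReal.coe_le_coe_iff.1 (h4.trans hR.le)⟩

end OdeLp

namespace OdeLp

variable {p f g x : ℝ → ℝ} {C D : Set ℝ}

/-! ### Compact sets of continuity of the exponent -/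

/-- `p` is measurable on `[0,1]` with values in `(1,∞)`, with no bound imposed. -/
structure IsExponent (p : ℝ → ℝ) : Prop where
  aemeasurable : AEMeasurable p unitMeasure
  one_lt : ∀ t ∈ Icc (0 : ℝ) 1, 1 < p t

theorem IsExponent.conj (hp : IsExponent p) : IsExponent (conj p) :=
  ⟨hp.aemeasurable.div (hp.aemeasurable.sub_const 1),
    fun t ht => (holderConjugate_conj (hp.one_lt t ht)).symm.lt⟩

theorem lusinSets_subset_conj (hp : IsExponent p) : lusinSets p ⊆ lusinSets (conj p) :=
  fun _ hC => ⟨hC.1, hC.2.1, hC.2.2.div (hC.2.2.sub continuousOn_const) fun t ht => by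
    have := hp.one_lt t (hC.2.1 ht)
    linarith⟩

theorem lusinSets_conj (hp : IsExponent p) : lusinSets (conj p) = lusinSets p := by
  refine subset_antisymm (fun C hC => ?_) (lusinSets_subset_conj hp)
  have h := lusinSets_subset_conj hp.conj hC
  refine ⟨h.1, h.2.1, h.2.2.congr fun t ht => ?_⟩
  exact (holderConjugate_conj (hp.one_lt t (h.2.1 ht))).symm.conjExponent_eq.symm

theorem union_mem_lusinSets (hC : C ∈ lusinSets p) (hD : D ∈ lusinSets p) :
    C ∪ D ∈ lusinSets p :=
  ⟨hC.1.union hD.1, union_subset hC.2.1 hD.2.1,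
    hC.2.2.union_of_isClosed hD.2.2 hC.1.isClosed hD.1.isClosed⟩

theorem empty_mem_lusinSets : ∅ ∈ lusinSets p :=
  ⟨isCompact_empty, empty_subset _, continuousOn_empty p⟩

/-- Lusin's theorem: for each member `U` of a countable basis, choose compact sets inside `p⁻¹ U` and
inside its complement that nearly exhaust them. On the intersection over `U` of their unions, `p` is
continuous. -/
theorem exists_mem_lusinSets_measure_lt (hp : AEMeasurable p unitMeasure) {ε : ℝ≥0∞}
    (hε : ε ≠ 0) : ∃ C ∈ lusinSets p, unitMeasure Cᶜ < ε := by
  set p' := hp.mk p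
  have hp'm : Measurable p' := hp.measurable_mk
  set Z := toMeasurable unitMeasure {t | p t ≠ p' t}
  have hZ0 : unitMeasure Z = 0 := by
    rw [measure_toMeasurable]
    exact ae_iff.1 hp.ae_eq_mk
  set E : Set ℝ := Icc 0 1 ∩ Zᶜ
  have hE : MeasurableSet E := measurableSet_Icc.inter (measurableSet_toMeasurable _ _).compl
  have hEp : ∀ t ∈ E, p t = p' t := fun t ht => by
    by_contra hne
    exact ht.2 (subset_toMeasurable _ _ hne)
  have hEc : unitMeasure Eᶜ = 0 := by
    rw [compl_inter, compl_compl]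
    refine measure_union_null ?_ hZ0
    exact mem_ae_iff.1 ae_mem_unit
  let B := TopologicalSpace.countableBasis ℝ
  have hBc : Countable B := (TopologicalSpace.countable_countableBasis ℝ).to_subtype
  obtain ⟨ε', hε'0, hε'⟩ := ENNReal.exists_pos_sum_of_countable hε B
  have hεne : ∀ U : B, (ε' U : ℝ≥0∞) / 2 ≠ 0 := fun U => by
    simpa using (hε'0 U).ne'
  have hpre : ∀ U : B, MeasurableSet (p' ⁻¹' U) := fun U =>
    hp'm (TopologicalSpace.isOpen_of_mem_countableBasis U.2).measurableSet
  choose K hK1 hK2 hK3 using fun U : B => (hE.inter (hpre U)).exists_isCompact_sdiff_lt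
    (measure_ne_top unitMeasure _) (hεne U)
  choose L hL1 hL2 hL3 using fun U : B => (hE.inter (hpre U).compl).exists_isCompact_sdiff_lt
    (measure_ne_top unitMeasure _) (hεne U)
  let C : Set ℝ := Icc 0 1 ∩ ⋂ U : B, (K U ∪ L U)
  have hCE : ∀ U : B, (K U ∪ L U) ⊆ E := fun U =>
    union_subset ((hK1 U).trans inter_subset_left) ((hL1 U).trans inter_subset_left)
  refine ⟨C, ⟨isCompact_Icc.inter_right (isClosed_iInter fun U =>
    (hK2 U).isClosed.union (hL2 U).isClosed), inter_subset_left, fun t ht => ?_⟩, ?_⟩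
  · have hmem : ∀ s ∈ C, ∀ U : B, s ∈ K U ∪ L U := fun s hs => mem_iInter.1 hs.2
    refine ((TopologicalSpace.isBasis_countableBasis ℝ).nhds_hasBasis.tendsto_right_iff).2
      fun U hU => ?_
    let U' : B := ⟨U, hU.1⟩
    have htE : t ∈ E := hCE U' (hmem t ht U')
    have htL : t ∉ L U' := fun h => (hL1 U' h).2 (by
      change p' t ∈ U
      rw [← hEp t htE]
      exact hU.2)
    filter_upwards [self_mem_nhdsWithin,
      mem_nhdsWithin_of_mem_nhds ((hL2 U').isClosed.isOpen_compl.mem_nhds htL)] with s hs hsL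
    have hsK : s ∈ K U' := (hmem s hs U').resolve_right hsL
    change p s ∈ U
    rw [hEp s (hCE U' (hmem s hs U'))]
    exact (hK1 U' hsK).2
  · have hsub : Cᶜ ⊆ Eᶜ ∪ ⋃ U : B, ((E ∩ p' ⁻¹' U) \ K U ∪ (E ∩ (p' ⁻¹' U)ᶜ) \ L U) := by
      intro t ht
      by_cases htE : t ∈ E
      · right
        by_contra hcon
        refine ht ⟨htE.1, mem_iInter.2 fun U => ?_⟩
        by_contra hKL
        refine hcon (mem_iUnion.2 ⟨U, ?_⟩)
        by_cases hU : t ∈ p' ⁻¹' (U : Set ℝ)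
        · exact Or.inl ⟨⟨htE, hU⟩, fun h => hKL (Or.inl h)⟩
        · exact Or.inr ⟨⟨htE, hU⟩, fun h => hKL (Or.inr h)⟩
      · exact Or.inl htE
    refine lt_of_le_of_lt ?_ hε'
    calc unitMeasure Cᶜ
        ≤ unitMeasure Eᶜ + unitMeasure (⋃ U : B, ((E ∩ p' ⁻¹' U) \ K U ∪
            (E ∩ (p' ⁻¹' U)ᶜ) \ L U)) := (measure_mono hsub).trans (measure_union_le _ _)
      _ ≤ 0 + ∑' U : B, (unitMeasure ((E ∩ p' ⁻¹' U) \ K U) +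
            unitMeasure ((E ∩ (p' ⁻¹' U)ᶜ) \ L U)) := by
        rw [hEc]
        gcongr
        exact (measure_iUnion_le _).trans (ENNReal.tsum_le_tsum fun U => measure_union_le _ _)
      _ ≤ ∑' U : B, (ε' U : ℝ≥0∞) := by
        rw [zero_add]
        refine ENNReal.tsum_le_tsum fun U => ?_
        calc _ ≤ (ε' U : ℝ≥0∞) / 2 + (ε' U : ℝ≥0∞) / 2 := add_le_add (hK3 U).le (hL3 U).le
          _ = _ := ENNReal.add_halves _

/-- `[0,1]` is exhausted, up to a null set, by an increasing sequence of compact sets on which `p` is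
continuous. -/
theorem exists_lusin_exhaustion (hp : AEMeasurable p unitMeasure) :
    ∃ K : ℕ → Set ℝ, (∀ n, K n ∈ lusinSets p) ∧ Monotone K ∧
      ∀ᵐ t ∂unitMeasure, ∃ n, t ∈ K n := by
  choose C hC hCm using fun n : ℕ => exists_mem_lusinSets_measure_lt hp
    (ε := (n : ℝ≥0∞)⁻¹) (by simp)
  refine ⟨accumulate C, fun n => ?_, monotone_accumulate, ?_⟩
  · induction n with
    | zero => simpa [accumulate] using hC 0
    | succ n ih => rw [accumulate_succ]; exact union_mem_lusinSets ih (hC _)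
  · rw [ae_iff]
    refine le_antisymm (ge_of_tendsto ENNReal.tendsto_inv_nat_nhds_zero
      (Eventually.of_forall fun n => ?_)) zero_le
    refine (measure_mono fun t ht => ?_).trans (hCm n).le
    exact fun h => ht ⟨n, subset_accumulate h⟩

/-- The exponent that equals `p` on `C` and `2` elsewhere. As `2` is its own conjugate, the
construction commutes with passing to conjugate exponents. -/
noncomputable def lusinExponent (p : ℝ → ℝ) (C : Set ℝ) : ℝ → ℝ :=
  fun t => C.indicator (fun t => p t - 2) t + 2

theorem lusinExponent_of_mem {t : ℝ} (h : t ∈ C) : lusinExponent p C t = p t := by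
  simp [lusinExponent, h]

theorem lusinExponent_of_notMem {t : ℝ} (h : t ∉ C) : lusinExponent p C t = 2 := by
  simp [lusinExponent, h]

theorem conj_lusinExponent : conj (lusinExponent p C) = lusinExponent (conj p) C := by
  funext t
  by_cases h : t ∈ C
  · simp only [conj, lusinExponent_of_mem h]
  · simp only [conj, lusinExponent_of_notMem h, Real.conjExponent]
    norm_num

theorem isBddExponent_lusinExponent (hp : IsExponent p) (hC : C ∈ lusinSets p) :
    IsBddExponent (lusinExponent p C) := by
  refine ⟨((hp.aemeasurable.sub_const 2).indicator hC.1.measurableSet).add_const 2, ?_⟩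
  obtain ⟨r, hr, hrC⟩ := hC.1.exists_forall_le' hC.2.2 fun t ht => hp.one_lt t (hC.2.1 ht)
  obtain ⟨R, hR⟩ := hC.1.bddAbove_image hC.2.2
  refine ⟨min r 2, max R 2, lt_min hr (by norm_num), Eventually.of_forall fun t => ?_⟩
  by_cases h : t ∈ C
  · rw [lusinExponent_of_mem h]
    exact ⟨(min_le_left _ _).trans (hrC t h), (hR (mem_image_of_mem p h)).trans (le_max_left _ _)⟩
  · rw [lusinExponent_of_notMem h]
    exact ⟨min_le_right _ _, le_max_right _ _⟩

/-- The norm of a function supported in `C` depends only on the exponent on `C`. -/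
theorem lpNorm_eq_lusinExponent (hp : IsExponent p) (hf : ∀ t ∉ C, f t = 0) :
    lpNorm p f = lpNorm (lusinExponent p C) f := by
  refine lpNorm_congr_odeRhs ?_
  filter_upwards [ae_mem_unit] with t ht s _
  by_cases h : t ∈ C
  · simp only [odeRhs, lusinExponent_of_mem h]
  · have h1 := hp.one_lt t ht
    rw [odeRhs_of_eq_zero (by linarith) (hf t h), odeRhs_of_eq_zero _ (hf t h)]
    rw [lusinExponent_of_notMem h]
    norm_num

theorem lpNorm_indicator_eq (hp : IsExponent p) (C : Set ℝ) (f : ℝ → ℝ) :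
    lpNorm p (C.indicator f) = lpNorm (lusinExponent p C) (C.indicator f) :=
  lpNorm_eq_lusinExponent hp fun _ ht => indicator_of_notMem ht f

/-! ### The tilde norm -/

theorem le_tildeNorm (hC : C ∈ lusinSets p) : lpNorm p (C.indicator f) ≤ tildeNorm p f :=
  le_iSup₂ (f := fun C (_ : C ∈ lusinSets p) => lpNorm p (C.indicator f)) C hC

theorem indicator_ae_eq {C : Set ℝ} (h : f =ᵐ[unitMeasure] g) :
    C.indicator f =ᵐ[unitMeasure] C.indicator g := by
  filter_upwards [h] with t ht
  by_cases htC : t ∈ C <;> simp [htC, ht]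

theorem tildeNorm_congr (h : f =ᵐ[unitMeasure] g) : tildeNorm p f = tildeNorm p g := by
  simp only [tildeNorm, lpNorm_congr (p := p) (indicator_ae_eq h)]

theorem memLpVar_indicator (hp : IsExponent p) (hC : C ∈ lusinSets p)
    (hf : AEMeasurable f unitMeasure) (hfN : tildeNorm p f < ∞) :
    MemLpVar (lusinExponent p C) (C.indicator f) :=
  ⟨hf.indicator hC.1.measurableSet,
    (lpNorm_indicator_eq hp C f).symm.trans_lt ((le_tildeNorm hC).trans_lt hfN)⟩

/-- Restricting a function to `C` does not take it out of the space: its tilde norm is at most its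
norm for the exponent that is bounded. -/
theorem tildeNorm_indicator_le (hp : IsExponent p) (hC : C ∈ lusinSets p)
    (hf : AEMeasurable f unitMeasure) :
    tildeNorm p (C.indicator f) ≤ lpNorm (lusinExponent p C) f := by
  refine iSup₂_le fun D hD => ?_
  rw [lpNorm_eq_lusinExponent (C := C) hp fun t ht => by
    by_cases htD : t ∈ D <;> simp [htD, ht]]
  refine lpNorm_mono (isBddExponent_lusinExponent hp hC)
    ((hf.indicator hC.1.measurableSet).indicator hD.1.measurableSet)
    (Eventually.of_forall fun t => ?_)
  by_cases htD : t ∈ D <;> by_cases htC : t ∈ C <;> simp [htD, htC]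

theorem isExtendedNorm_tildeNorm (hp : IsExponent p) : IsExtendedNorm (tildeNorm p) where
  add_le f g := by
    rw [tildeNorm_congr (AEEqFun.coeFn_add f g)]
    refine iSup₂_le fun C hC => ?_
    have hb := isBddExponent_lusinExponent hp hC
    have h1 := lpNorm_add_le hb (f.aemeasurable.indicator hC.1.measurableSet)
      (g.aemeasurable.indicator hC.1.measurableSet)
    have e : (fun t => C.indicator f t + C.indicator g t) = C.indicator (⇑f + ⇑g) := by
      funext t
      by_cases ht : t ∈ C <;> simp [ht]
    rw [e, ← lpNorm_indicator_eq hp, ← lpNorm_indicator_eq hp, ← lpNorm_indicator_eq hp] at h1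
    exact h1.trans (add_le_add (le_tildeNorm hC) (le_tildeNorm hC))
  smul c f := by
    rw [tildeNorm_congr (AEEqFun.coeFn_smul c f)]
    simp only [tildeNorm, ENNReal.mul_iSup]
    refine iSup_congr fun C => iSup_congr fun hC => ?_
    have hb := isBddExponent_lusinExponent hp hC
    have e : C.indicator (c • ⇑f) = fun t => c * C.indicator f t := by
      funext t
      by_cases ht : t ∈ C <;> simp [ht]
    rw [lpNorm_indicator_eq hp, lpNorm_indicator_eq hp, e,
      lpNorm_const_mul hb (f.aemeasurable.indicator hC.1.measurableSet)]
  eq_zero f h := by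
    obtain ⟨K, hK, _, hKae⟩ := exists_lusin_exhaustion hp.aemeasurable
    refine AEEqFun.ext (EventuallyEq.trans ?_ AEEqFun.coeFn_zero.symm)
    have h1 : ∀ n, ∀ᵐ t ∂unitMeasure, (K n).indicator f t = 0 := fun n => by
      refine ae_eq_zero_of_lpNorm_eq_zero (isBddExponent_lusinExponent hp (hK n)) ?_
      rw [← lpNorm_indicator_eq hp]
      exact le_antisymm ((le_tildeNorm (hK n)).trans h.le) zero_le
    filter_upwards [ae_all_iff.2 h1, hKae] with t ht ⟨n, hn⟩
    simpa [hn] using ht n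

/-- Hölder's inequality for the tilde norms. -/
theorem integral_abs_mul_le_tildeNorm (hp : IsExponent p) (hx : AEMeasurable x unitMeasure)
    (hf : AEMeasurable f unitMeasure) (hxN : tildeNorm p x < ∞) (hfN : tildeNorm (conj p) f < ∞) :
    Integrable (fun t => x t * f t) unitMeasure ∧
      ∫ t, |x t * f t| ∂unitMeasure ≤ (tildeNorm p x).toReal * (tildeNorm (conj p) f).toReal := by
  obtain ⟨K, hK, hKmono, hKae⟩ := exists_lusin_exhaustion hp.aemeasurable
  set M := (tildeNorm p x).toReal * (tildeNorm (conj p) f).toReal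
  have hle : ∀ n, Integrable (fun t => (K n).indicator x t * (K n).indicator f t) unitMeasure ∧
      ∫ t, |(K n).indicator x t * (K n).indicator f t| ∂unitMeasure ≤ M := by
    intro n
    have hKq : K n ∈ lusinSets (conj p) := lusinSets_subset_conj hp (hK n)
    have h1 := memLpVar_indicator hp (hK n) hx hxN
    have h2 := memLpVar_indicator hp.conj hKq hf hfN
    rw [← conj_lusinExponent] at h2
    have h3 := integral_abs_mul_le (isBddExponent_lusinExponent hp (hK n)) h1.1 h2.1 h1.2 h2.2
    refine ⟨h3.1, h3.2.trans ?_⟩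
    rw [conj_lusinExponent, ← lpNorm_indicator_eq hp, ← lpNorm_indicator_eq hp.conj]
    exact mul_le_mul (ENNReal.toReal_mono hxN.ne (le_tildeNorm (hK n)))
      (ENNReal.toReal_mono hfN.ne (le_tildeNorm hKq)) ENNReal.toReal_nonneg ENNReal.toReal_nonneg
  have hlim : ∀ᵐ t ∂unitMeasure, Tendsto (fun n => (K n).indicator x t * (K n).indicator f t) atTop
      (𝓝 (x t * f t)) := by
    filter_upwards [hKae] with t ⟨N, hN⟩
    refine tendsto_const_nhds.congr' ?_
    filter_upwards [eventually_ge_atTop N] with n hn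
    have : t ∈ K n := hKmono hn hN
    simp [this]
  have hint : Integrable (fun t => x t * f t) unitMeasure := by
    refine integrable_of_tendsto hlim (fun n => (hle n).1.1) ?_
    refine ne_top_of_le_ne_top (ENNReal.ofReal_ne_top (r := M))
      (liminf_le_of_le (by isBoundedDefault) fun b hb => ?_)
    obtain ⟨n, hn⟩ := hb.exists
    refine hn.trans ?_
    rw [← ofReal_integral_norm_eq_lintegral_enorm (hle n).1]
    exact ENNReal.ofReal_le_ofReal (hle n).2
  refine ⟨hint, ?_⟩
  have h1 := tendsto_integral_of_dominated_convergence (μ := unitMeasure)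
    (F := fun n t => |(K n).indicator x t * (K n).indicator f t|) (f := fun t => |x t * f t|)
    (fun t => |x t * f t|) (fun n => (hle n).1.1.norm) hint.abs
    (fun n => Eventually.of_forall fun t => by
      by_cases ht : t ∈ K n <;> simp [ht, mul_nonneg])
    (by filter_upwards [hlim] with t ht using ht.abs)
  exact le_of_tendsto h1 (Eventually.of_forall fun n => (hle n).2)

/-- The tilde norm is nearly attained on one set of continuity. -/
theorem exists_toReal_tildeNorm_sub_le (hfN : tildeNorm p f < ∞) {ε : ℝ} (hε : 0 < ε) :
    ∃ C ∈ lusinSets p, (tildeNorm p f).toReal - ε ≤ (lpNorm p (C.indicator f)).toReal := by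
  by_contra! h
  have h0 := ENNReal.toReal_nonneg.trans_lt (h ∅ empty_mem_lusinSets)
  have h1 : tildeNorm p f ≤ ENNReal.ofReal ((tildeNorm p f).toReal - ε) :=
    iSup₂_le fun C hC => (ENNReal.le_ofReal_iff_toReal_le ((le_tildeNorm hC).trans_lt hfN).ne
      h0.le).2 (h C hC).le
  have h2 := ENNReal.toReal_le_of_le_ofReal h0.le h1
  linarith

end OdeLp

namespace OdeLp

variable {p f g x : ℝ → ℝ} {C D : Set ℝ}

/-! ### Functionals on the closure of the functions supported where the exponent is bounded -/

theorem coeFn_lt_top {N : (ℝ → ℝ) → ℝ≥0∞} (hN : ∀ {f g : ℝ → ℝ}, f =ᵐ[unitMeasure] g → N f = N g)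
    (hf : AEMeasurable f unitMeasure) (h : N f < ∞) : N (mkL0 f hf) < ∞ :=
  (hN (coeFn_mkL0 hf)).trans_lt h

theorem mem_lpZero (h : IsExtendedNorm (tildeNorm p)) (g : FiniteSpace h) (n : ℕ)
    (hn : ∀ᵐ t ∂unitMeasure, g.toL0 t ≠ 0 → p t ≤ n) : g ∈ lpZero p h := by
  refine Submodule.le_topologicalClosure _ (Submodule.subset_span ⟨n, g, ?_⟩)
  filter_upwards [hn] with t ht
  by_cases h0 : g.toL0 t = 0
  · by_cases h1 : t ∈ {t | p t ≤ n} <;> simp [indicator, h0]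
  · exact (indicator_of_mem (s := {t | p t ≤ n}) (ht h0) _).symm

theorem lpZero_ext {h : IsExtendedNorm (tildeNorm p)} {y z : lpZero p h}
    (hyz : y.1.toL0 =ᵐ[unitMeasure] z.1.toL0) : y = z :=
  Subtype.ext (FiniteSpace.ext (AEEqFun.ext hyz))

/-- The restriction to a set of continuity `C` of a function whose norm over `C` is finite, as an
element of `L₀^{p(·)}`. -/
noncomputable def restrictLusin (hp : IsExponent p) (hC : C ∈ lusinSets p) (x : ℝ → ℝ)
    (hx : MemLpVar (lusinExponent p C) x) : lpZero p (isExtendedNorm_tildeNorm hp) :=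
  ⟨FiniteSpace.mk _ (mkL0 (C.indicator x) (hx.1.indicator hC.1.measurableSet))
    (coeFn_lt_top tildeNorm_congr _ ((tildeNorm_indicator_le hp hC hx.1).trans_lt hx.2)), by
    obtain ⟨R, hR⟩ := hC.1.bddAbove_image hC.2.2
    obtain ⟨n, hn⟩ := exists_nat_ge R
    refine mem_lpZero _ _ n ?_
    filter_upwards [coeFn_mkL0 (hx.1.indicator hC.1.measurableSet)] with t ht h0
    rw [FiniteSpace.toL0_mk, ht] at h0
    exact (hR (mem_image_of_mem p (mem_of_indicator_ne_zero h0))).trans hn⟩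

theorem coeFn_restrictLusin (hp : IsExponent p) (hC : C ∈ lusinSets p)
    (hx : MemLpVar (lusinExponent p C) x) :
    (restrictLusin hp hC x hx).1.toL0 =ᵐ[unitMeasure] C.indicator x :=
  coeFn_mkL0 (hx.1.indicator hC.1.measurableSet)

theorem norm_restrictLusin_le (hp : IsExponent p) (hC : C ∈ lusinSets p)
    (hx : MemLpVar (lusinExponent p C) x) :
    ‖restrictLusin hp hC x hx‖ ≤ (lpNorm (lusinExponent p C) x).toReal := by
  rw [Submodule.coe_norm, FiniteSpace.norm_eq, tildeNorm_congr (coeFn_restrictLusin hp hC hx)]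
  exact ENNReal.toReal_mono hx.2.ne (tildeNorm_indicator_le hp hC hx.1)

theorem restrictLusin_eq (hp : IsExponent p) (hC : C ∈ lusinSets p) (hD : D ∈ lusinSets p)
    {y : ℝ → ℝ} (hx : MemLpVar (lusinExponent p C) x) (hy : MemLpVar (lusinExponent p D) y)
    (hxy : C.indicator x = D.indicator y) :
    restrictLusin hp hC x hx = restrictLusin hp hD y hy :=
  lpZero_ext ((coeFn_restrictLusin hp hC hx).trans
    (hxy ▸ (coeFn_restrictLusin hp hD hy).symm))

/-- On the set of continuity `C`, the functional `F` is integration against `g`, a function of norm at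
most `‖F‖` for the bounded conjugate exponent; the values of `g` off `C` are arbitrary up to this
bound. -/
structure RepresentsOn (hp : IsExponent p)
    (F : StrongDual ℝ (lpZero p (isExtendedNorm_tildeNorm hp))) (C : Set ℝ) (g : ℝ → ℝ) :
    Prop where
  mem : MemLpVar (conj (lusinExponent p C)) g
  norm_le : lpNorm (conj (lusinExponent p C)) g ≤ ENNReal.ofReal ‖F‖
  eq : ∀ (hC : C ∈ lusinSets p) (x : ℝ → ℝ) (hx : MemLpVar (lusinExponent p C) x),
    F (restrictLusin hp hC x hx) = ∫ t, x t * g t ∂unitMeasure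

section
variable (hp : IsExponent p) (F : StrongDual ℝ (lpZero p (isExtendedNorm_tildeNorm hp)))

theorem exists_representsOn (hC : C ∈ lusinSets p) : ∃ g, RepresentsOn hp F C g := by
  classical
  have hb := isBddExponent_lusinExponent hp hC
  let Λ : (ℝ → ℝ) → ℝ := fun x =>
    if hx : MemLpVar (lusinExponent p C) x then F (restrictLusin hp hC x hx) else 0
  have hΛ : ∀ {x} (hx : MemLpVar (lusinExponent p C) x), Λ x = F (restrictLusin hp hC x hx) :=
    fun hx => dif_pos hx
  have hbdd : IsBddFunctional (lusinExponent p C) ‖F‖ Λ :=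
    { add := fun f g hf hg => by
        rw [hΛ hf, hΛ hg, hΛ (hf.add hb hg), ← map_add]
        congr 1
        refine lpZero_ext ((coeFn_restrictLusin hp hC _).trans (EventuallyEq.symm ?_))
        refine (FiniteSpace.coeFn_add _ _).trans ?_
        filter_upwards [coeFn_restrictLusin hp hC hf, coeFn_restrictLusin hp hC hg] with t h1 h2
        rw [h1, h2]
        by_cases ht : t ∈ C <;> simp [ht]
      smul := fun c f hf => by
        rw [hΛ hf, hΛ (hf.const_mul hb c), ← smul_eq_mul, ← map_smul]
        congr 1
        refine lpZero_ext ((coeFn_restrictLusin hp hC _).trans (EventuallyEq.symm ?_))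
        refine (FiniteSpace.coeFn_smul _ _).trans ?_
        filter_upwards [coeFn_restrictLusin hp hC hf] with t h1
        rw [h1]
        by_cases ht : t ∈ C <;> simp [ht]
      bound := fun f hf => by
        rw [hΛ hf]
        refine (F.le_opNorm _).trans ?_
        have := norm_restrictLusin_le hp hC hf
        gcongr }
  obtain ⟨g, hg, hgN, hrep⟩ := hbdd.exists_eq_integral hb (norm_nonneg F)
  exact ⟨g, ⟨hg, hgN.trans_lt ENNReal.ofReal_lt_top⟩, hgN, fun hC' x hx => by
    rw [← hrep x hx, hΛ hx]⟩

variable {hp F}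

theorem RepresentsOn.integrable (hC : C ∈ lusinSets p) (hg : RepresentsOn hp F C g) :
    Integrable g unitMeasure := by
  have hb := isBddExponent_lusinExponent hp hC
  have h1 := memLpVar_indicator_one hb MeasurableSet.univ
  simpa using (integral_abs_mul_le hb h1.1 hg.mem.1 h1.2 hg.mem.2).1

/-- The representing functions on two sets of continuity agree on the intersection. -/
theorem RepresentsOn.ae_eq (hC : C ∈ lusinSets p) (hD : D ∈ lusinSets p) {g' : ℝ → ℝ}
    (hg : RepresentsOn hp F C g) (hg' : RepresentsOn hp F D g') :
    ∀ᵐ t ∂unitMeasure, t ∈ C ∩ D → g t = g' t := by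
  have hS : MeasurableSet (C ∩ D) := hC.1.measurableSet.inter hD.1.measurableSet
  have hbC := isBddExponent_lusinExponent hp hC
  have hbD := isBddExponent_lusinExponent hp hD
  have hset : ∀ (A : Set ℝ) (u : ℝ → ℝ), MeasurableSet A →
      ∫ t in A, (C ∩ D).indicator u t ∂unitMeasure =
        ∫ t, (A ∩ (C ∩ D)).indicator 1 t * u t ∂unitMeasure := fun A u hA => by
    rw [setIntegral_indicator hS, ← integral_indicator (hA.inter hS)]
    refine integral_congr_ae (Eventually.of_forall fun t => ?_)
    by_cases ht : t ∈ A ∩ (C ∩ D)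
    · simp only [indicator_of_mem ht, Pi.one_apply, one_mul]
    · simp only [indicator_of_notMem ht, zero_mul]
  have key : (C ∩ D).indicator g =ᵐ[unitMeasure] (C ∩ D).indicator g' := by
    refine Integrable.ae_eq_of_forall_setIntegral_eq _ _ ((hg.integrable hC).indicator hS)
      ((hg'.integrable hD).indicator hS) fun A hA _ => ?_
    have hAS := hA.inter hS
    rw [hset A g hA, hset A g' hA, ← hg.eq hC _ (memLpVar_indicator_one hbC hAS),
      ← hg'.eq hD _ (memLpVar_indicator_one hbD hAS)]
    congr 1
    refine restrictLusin_eq hp hC hD _ _ ?_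
    rw [indicator_indicator, indicator_indicator]
    congr 1
    ext t
    simp only [mem_inter_iff]
    tauto
  filter_upwards [key] with t ht hmem
  rwa [indicator_of_mem hmem, indicator_of_mem hmem] at ht

variable (F)

/-- The local representing functions glue to a function whose tilde norm is at most `‖F‖`. -/
theorem exists_forall_lusinSets_eq_integral :
    ∃ f : ℝ → ℝ, AEMeasurable f unitMeasure ∧ tildeNorm (conj p) f ≤ ENNReal.ofReal ‖F‖ ∧
      ∀ C (hC : C ∈ lusinSets p) x (hx : MemLpVar (lusinExponent p C) x),
        F (restrictLusin hp hC x hx) = ∫ t, C.indicator x t * f t ∂unitMeasure := by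
  obtain ⟨K, hK, hKmono, hKae⟩ := exists_lusin_exhaustion hp.aemeasurable
  choose G hG using fun n => exists_representsOn hp F (hK n)
  have hcons : ∀ᵐ t ∂unitMeasure, ∀ m n, t ∈ K m ∩ K n → G m t = G n t :=
    ae_all_iff.2 fun m => ae_all_iff.2 fun n => (hG m).ae_eq (hK m) (hK n) (hG n)
  have hev : ∀ᵐ t ∂unitMeasure, ∀ m, t ∈ K m →
      Tendsto (fun n => (K n).indicator (G n) t) atTop (𝓝 (G m t)) := by
    filter_upwards [hcons] with t ht m hm
    refine tendsto_const_nhds.congr' ?_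
    filter_upwards [eventually_ge_atTop m] with n hn
    have hn' : t ∈ K n := hKmono hn hm
    rw [indicator_of_mem hn', ht m n ⟨hm, hn'⟩]
  obtain ⟨f, hfm, hf⟩ := measurable_limit_of_tendsto_metrizable_ae (μ := unitMeasure) (L := atTop)
    (f := fun n => (K n).indicator (G n))
    (fun n => (hG n).mem.1.indicator (hK n).1.measurableSet) (by
      filter_upwards [hev, hKae] with t ht ⟨m, hm⟩ using ⟨_, ht m hm⟩)
  have hfG : ∀ᵐ t ∂unitMeasure, ∀ m, t ∈ K m → f t = G m t := by
    filter_upwards [hev, hf] with t h1 h2 m hm using tendsto_nhds_unique h2 (h1 m hm)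
  have hfC : ∀ C, C ∈ lusinSets p → ∀ g, RepresentsOn hp F C g →
      C.indicator f =ᵐ[unitMeasure] C.indicator g := by
    intro C hC g hg
    have h1 : ∀ᵐ t ∂unitMeasure, ∀ n, t ∈ C ∩ K n → g t = G n t :=
      ae_all_iff.2 fun n => hg.ae_eq hC (hK n) (hG n)
    filter_upwards [h1, hfG, hKae] with t h2 h3 ⟨n, hn⟩
    by_cases ht : t ∈ C
    · rw [indicator_of_mem ht, indicator_of_mem ht, h3 n hn, h2 n ⟨ht, hn⟩]
    · simp [ht]
  refine ⟨f, hfm.aemeasurable, iSup₂_le fun C hC => ?_, fun C hC x hx => ?_⟩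
  · rw [lusinSets_conj hp] at hC
    have hb := isBddExponent_lusinExponent hp hC
    obtain ⟨g, hg⟩ := exists_representsOn hp F hC
    rw [lpNorm_indicator_eq hp.conj, ← conj_lusinExponent, lpNorm_congr (hfC C hC g hg)]
    refine (lpNorm_mono hb.conj (hg.mem.1.indicator hC.1.measurableSet)
      (Eventually.of_forall fun t => ?_)).trans hg.norm_le
    simpa using norm_indicator_le_norm_self (s := C) g t
  · have hb := isBddExponent_lusinExponent hp hC
    obtain ⟨g, hg⟩ := exists_representsOn hp F hC
    have hx' := hx.indicator hb hC.1.measurableSet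
    have e1 : restrictLusin hp hC x hx = restrictLusin hp hC (C.indicator x) hx' :=
      restrictLusin_eq hp hC hC _ _ (by rw [indicator_indicator, inter_self])
    rw [e1, hg.eq hC _ hx']
    refine integral_congr_ae ?_
    filter_upwards [hfC C hC g hg] with t ht
    by_cases htC : t ∈ C
    · rw [indicator_of_mem htC, indicator_of_mem htC] at ht
      rw [ht]
    · simp [htC]

end

/-- A function of finite tilde norm that is supported where `p ≤ R` has finite modular. -/
theorem integrable_modular_of_tildeNorm_lt_top (hp : IsExponent p) (hg : AEMeasurable g unitMeasure)
    (hgN : tildeNorm p g < ∞) {R : ℝ} (hR1 : 1 ≤ R)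
    (hR : ∀ᵐ t ∂unitMeasure, g t ≠ 0 → p t ≤ R) :
    Integrable (fun t => |g t| ^ p t) unitMeasure := by
  obtain ⟨K, hK, hKmono, hKae⟩ := exists_lusin_exhaustion hp.aemeasurable
  set M := (tildeNorm p g).toReal
  have hmem := fun n => memLpVar_indicator hp (hK n) hg hgN
  refine integrable_of_tendsto
    (G := fun n t => |(K n).indicator g t| ^ lusinExponent p (K n) t) ?_
    (fun n => (aemeasurable_modular (isBddExponent_lusinExponent hp (hK n)).aemeasurable
      (hmem n).1).aestronglyMeasurable) ?_
  · filter_upwards [hKae] with t ⟨m, hm⟩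
    refine tendsto_const_nhds.congr' ?_
    filter_upwards [eventually_ge_atTop m] with n hn
    have hn' : t ∈ K n := hKmono hn hm
    rw [indicator_of_mem hn', lusinExponent_of_mem hn']
  · refine ne_top_of_le_ne_top (ENNReal.ofReal_ne_top (r := R * (1 + M) ^ (R - 1) * M))
      (liminf_le_of_le (by isBoundedDefault) fun b hb => ?_)
    obtain ⟨n, hn⟩ := hb.exists
    refine hn.trans ?_
    have hbK := isBddExponent_lusinExponent hp (hK n)
    have h1 := modular_le_of_lpNorm_le hbK (hmem n).1 hR1 (M := M) ENNReal.toReal_nonneg (by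
      filter_upwards [hR] with t ht h0
      have htK : t ∈ K n := mem_of_indicator_ne_zero h0
      rw [indicator_of_mem htK] at h0
      rw [lusinExponent_of_mem htK]
      exact ht h0) (by
      rw [← lpNorm_indicator_eq hp, ENNReal.ofReal_toReal hgN.ne]
      exact le_tildeNorm (hK n))
    rw [← ofReal_integral_norm_eq_lintegral_enorm ((hmem n).integrable hbK)]
    refine ENNReal.ofReal_le_ofReal (le_trans (le_of_eq ?_) h1)
    refine integral_congr_ae (Eventually.of_forall fun t => ?_)
    exact Real.norm_of_nonneg (by positivity)

/-- Where the exponent is bounded, restrictions to an exhaustion converge in the tilde norm. -/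
theorem tendsto_tildeNorm_indicator_compl (hp : IsExponent p) (hg : AEMeasurable g unitMeasure)
    (hgN : tildeNorm p g < ∞) {R : ℝ} (hR1 : 1 ≤ R)
    (hR : ∀ᵐ t ∂unitMeasure, g t ≠ 0 → p t ≤ R) {K : ℕ → Set ℝ} (hK : ∀ n, MeasurableSet (K n))
    (hKmono : Monotone K) (hKae : ∀ᵐ t ∂unitMeasure, ∃ n, t ∈ K n) :
    Tendsto (fun n => (tildeNorm p ((K n)ᶜ.indicator g)).toReal) atTop (𝓝 0) := by
  have hint := integrable_modular_of_tildeNorm_lt_top hp hg hgN hR1 hR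
  have hmeas : ∀ n, AEMeasurable ((K n)ᶜ.indicator g) unitMeasure := fun n =>
    hg.indicator (hK n).compl
  have hle : ∀ S : Set ℝ, ∀ᵐ t ∂unitMeasure, |S.indicator g t| ^ p t ≤ |g t| ^ p t := fun S => by
    filter_upwards [ae_mem_unit] with t ht
    have := hp.one_lt t ht
    refine Real.rpow_le_rpow (abs_nonneg _) ?_ (by linarith)
    simpa using norm_indicator_le_norm_self (s := S) g t
  have h1 : Tendsto (fun n => ∫ t, |(K n)ᶜ.indicator g t| ^ p t ∂unitMeasure) atTop (𝓝 0) := by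
    have := tendsto_integral_of_dominated_convergence (μ := unitMeasure)
      (F := fun n t => |(K n)ᶜ.indicator g t| ^ p t) (f := fun _ => 0) (fun t => |g t| ^ p t)
      (fun n => (aemeasurable_modular hp.aemeasurable (hmeas n)).aestronglyMeasurable) hint
      (fun n => by
        filter_upwards [hle (K n)ᶜ] with t ht
        rwa [Real.norm_of_nonneg (by positivity)])
      (by
        filter_upwards [hKae, ae_mem_unit] with t ⟨m, hm⟩ ht
        have := hp.one_lt t ht
        refine tendsto_const_nhds.congr' ?_
        filter_upwards [eventually_ge_atTop m] with n hn
        have hn' : t ∉ (K n)ᶜ := not_not.2 (hKmono hn hm)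
        rw [indicator_of_notMem hn', abs_zero, Real.zero_rpow (by linarith)])
    simpa using this
  rw [Metric.tendsto_nhds]
  intro ε hε
  obtain ⟨δ, hδ, hδ'⟩ := exists_modular_le_imp_lpNorm_le R (half_pos hε)
  filter_upwards [h1.eventually_lt_const hδ] with n hn
  have h2 : tildeNorm p ((K n)ᶜ.indicator g) ≤ ENNReal.ofReal (ε / 2) := by
    refine iSup₂_le fun C hC => ?_
    rw [lpNorm_indicator_eq hp]
    have hb := isBddExponent_lusinExponent hp hC
    have hmC := (hmeas n).indicator hC.1.measurableSet
    have hleC : ∀ᵐ t ∂unitMeasure, |C.indicator ((K n)ᶜ.indicator g) t| ^ lusinExponent p C t ≤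
        |(K n)ᶜ.indicator g t| ^ p t := by
      filter_upwards with t
      by_cases htC : t ∈ C
      · rw [indicator_of_mem htC, lusinExponent_of_mem htC]
      · rw [indicator_of_notMem htC, lusinExponent_of_notMem htC, abs_zero,
          Real.zero_rpow (by norm_num)]
        positivity
    have hintn : Integrable (fun t => |(K n)ᶜ.indicator g t| ^ p t) unitMeasure :=
      hint.mono' (aemeasurable_modular hp.aemeasurable (hmeas n)).aestronglyMeasurable (by
        filter_upwards [hle (K n)ᶜ] with t ht
        rwa [Real.norm_of_nonneg (by positivity)])
    have hintC : Integrable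
        (fun t => |C.indicator ((K n)ᶜ.indicator g) t| ^ lusinExponent p C t) unitMeasure :=
      hintn.mono' (aemeasurable_modular hb.aemeasurable hmC).aestronglyMeasurable (by
        filter_upwards [hleC] with t ht
        rwa [Real.norm_of_nonneg (by positivity)])
    refine hδ' _ _ hb hmC ?_ hintC ((integral_mono_ae hintC hintn hleC).trans hn.le)
    filter_upwards [hR] with t ht h0
    have htC : t ∈ C := mem_of_indicator_ne_zero h0
    rw [indicator_of_mem htC] at h0
    have htK : t ∈ (K n)ᶜ := mem_of_indicator_ne_zero h0
    rw [indicator_of_mem htK] at h0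
    rw [lusinExponent_of_mem htC]
    exact ht h0
  have h3 := ENNReal.toReal_le_of_le_ofReal (half_pos hε).le h2
  rw [Real.dist_eq, sub_zero, abs_of_nonneg ENNReal.toReal_nonneg]
  linarith

/-- Two continuous functionals on `L₀^{p(·)}` agree if they agree on the generators. -/
theorem lpZero_functional_ext {h : IsExtendedNorm (tildeNorm p)} (F G : StrongDual ℝ (lpZero p h))
    (hFG : ∀ y : lpZero p h, (∃ n : ℕ, ∀ᵐ t ∂unitMeasure, y.1.toL0 t ≠ 0 → p t ≤ n) → F y = G y) :
    F = G := by
  have hspan : ∀ u ∈ Submodule.span ℝ {g : FiniteSpace h | ∃ (n : ℕ) (f : FiniteSpace h),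
      ⇑g.toL0 =ᵐ[unitMeasure] {t | p t ≤ n}.indicator ⇑f.toL0},
      ∀ hu : u ∈ lpZero p h, F ⟨u, hu⟩ = G ⟨u, hu⟩ := by
    intro u hu
    induction hu using Submodule.span_induction with
    | mem u hu =>
      intro hu'
      obtain ⟨n, f, hn⟩ := hu
      refine hFG _ ⟨n, ?_⟩
      filter_upwards [hn] with t ht h0
      change u.toL0 t ≠ 0 at h0
      rw [ht] at h0
      exact mem_of_indicator_ne_zero (s := {t | p t ≤ n}) h0
    | zero =>
      intro hu'
      exact (map_zero F).trans (map_zero G).symm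
    | add u v hu hv ihu ihv =>
      intro huv
      have hu' := Submodule.le_topologicalClosure _ hu
      have hv' := Submodule.le_topologicalClosure _ hv
      have e : (⟨u + v, huv⟩ : lpZero p h) = ⟨u, hu'⟩ + ⟨v, hv'⟩ := rfl
      rw [e, map_add, map_add, ihu hu', ihv hv']
    | smul c u hu ihu =>
      intro hcu
      have hu' := Submodule.le_topologicalClosure _ hu
      have e : (⟨c • u, hcu⟩ : lpZero p h) = c • ⟨u, hu'⟩ := rfl
      rw [e, map_smul, map_smul, ihu hu']
  ext y
  obtain ⟨u, hu, hlim⟩ := mem_closure_iff_seq_limit.1 (y.2 : y.1 ∈ closure _)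
  have hu' : ∀ n, u n ∈ lpZero p h := fun n => Submodule.le_topologicalClosure _ (hu n)
  have hlim' : Tendsto (fun n => (⟨u n, hu' n⟩ : lpZero p h)) atTop (𝓝 y) :=
    tendsto_subtype_rng.2 hlim
  have h1 := (F.continuous.tendsto y).comp hlim'
  have h2 := (G.continuous.tendsto y).comp hlim'
  refine tendsto_nhds_unique h1 (h2.congr fun n => ?_)
  exact (hspan _ (hu n) (hu' n)).symm

end OdeLp

namespace OdeLp

variable {p : ℝ → ℝ}

/-! ### The dual of the closure -/

theorem hasHolder_tilde (hp : IsExponent p) (x : lpZero p (isExtendedNorm_tildeNorm hp))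
    (f : FiniteSpace (isExtendedNorm_tildeNorm hp.conj)) :
    Integrable (fun t => x.1.toL0 t * f.toL0 t) unitMeasure ∧
      |∫ t, x.1.toL0 t * f.toL0 t ∂unitMeasure| ≤ ‖f‖ * ‖x‖ := by
  have h1 := integral_abs_mul_le_tildeNorm hp x.1.toL0.aemeasurable f.toL0.aemeasurable
    x.1.lt_top f.lt_top
  refine ⟨h1.1, abs_integral_le_integral_abs.trans (h1.2.trans (le_of_eq ?_))⟩
  rw [mul_comm]
  rfl

/-- Every functional on `L₀^{p(·)}` is integration against a function of finite tilde norm. -/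
theorem exists_representing_tilde (hp : IsExponent p)
    (F : StrongDual ℝ (lpZero p (isExtendedNorm_tildeNorm hp))) :
    ∃ f : FiniteSpace (isExtendedNorm_tildeNorm hp.conj),
      ∀ x, F x = ∫ t, x.1.toL0 t * f.toL0 t ∂unitMeasure := by
  obtain ⟨f, hf, hfN, hrep⟩ := exists_forall_lusinSets_eq_integral F
  let f' : FiniteSpace (isExtendedNorm_tildeNorm hp.conj) := FiniteSpace.mk _ (mkL0 f hf)
    (coeFn_lt_top tildeNorm_congr hf (hfN.trans_lt ENNReal.ofReal_lt_top))
  have hf' : f'.toL0 =ᵐ[unitMeasure] f := coeFn_mkL0 hf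
  let G : StrongDual ℝ (lpZero p (isExtendedNorm_tildeNorm hp)) := LinearMap.mkContinuous
    { toFun := fun x => ∫ t, x.1.toL0 t * f'.toL0 t ∂unitMeasure
      map_add' := fun x y => by
        rw [← integral_add (hasHolder_tilde hp x f').1 (hasHolder_tilde hp y f').1]
        refine integral_congr_ae ?_
        filter_upwards [FiniteSpace.coeFn_add x.1 y.1] with t ht
        rw [Submodule.coe_add, ht, add_mul]
      map_smul' := fun c x => by
        rw [RingHom.id_apply, smul_eq_mul, ← integral_const_mul]
        refine integral_congr_ae ?_
        filter_upwards [FiniteSpace.coeFn_smul c x.1] with t ht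
        rw [Submodule.coe_smul, ht, mul_assoc] }
    ‖f'‖ (fun x => (hasHolder_tilde hp x f').2)
  have hG : ∀ x, G x = ∫ t, x.1.toL0 t * f'.toL0 t ∂unitMeasure := fun _ => rfl
  refine ⟨f', fun x => ?_⟩
  rw [← hG x]
  congr 1
  refine lpZero_functional_ext F G fun y ⟨n, hn⟩ => ?_
  -- `F` and `G` agree at the restrictions of `y` to the exhausting sets, which converge to `y`.
  obtain ⟨K, hK, hKmono, hKae⟩ := exists_lusin_exhaustion hp.aemeasurable
  set g : ℝ → ℝ := ⇑y.1.toL0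
  have hgm : AEMeasurable g unitMeasure := y.1.toL0.aemeasurable
  have hmem := fun m => memLpVar_indicator hp (hK m) hgm y.1.lt_top
  have hind : ∀ m, (K m).indicator ((K m).indicator g) = (K m).indicator g := fun m => by
    rw [indicator_indicator, inter_self]
  let z : ℕ → lpZero p (isExtendedNorm_tildeNorm hp) := fun m => restrictLusin hp (hK m) _ (hmem m)
  have hz : ∀ m, (z m).1.toL0 =ᵐ[unitMeasure] (K m).indicator g := fun m =>
    (coeFn_restrictLusin hp (hK m) (hmem m)).trans (by rw [hind])
  have hFG : ∀ m, F (z m) = G (z m) := fun m => by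
    rw [hrep, hG]
    refine integral_congr_ae ?_
    filter_upwards [hz m, hf'] with t h1 h2
    rw [h1, h2, hind]
  have hlim : Tendsto z atTop (𝓝 y) := by
    rw [tendsto_iff_norm_sub_tendsto_zero]
    refine (tendsto_tildeNorm_indicator_compl hp hgm y.1.lt_top (le_max_right (n : ℝ) 1) (by
      filter_upwards [hn] with t ht h0 using (ht h0).trans (le_max_left _ _))
      (fun m => (hK m).1.measurableSet) hKmono hKae).congr fun m => ?_
    rw [norm_sub_rev, Submodule.coe_norm, FiniteSpace.norm_eq]
    congr 1
    refine tildeNorm_congr (EventuallyEq.symm ?_)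
    filter_upwards [AEEqFun.coeFn_sub y.1.toL0 (z m).1.toL0, hz m] with t h1 h2
    refine h1.trans ?_
    rw [Pi.sub_apply, h2]
    by_cases ht : t ∈ K m
    · simp [ht, g]
    · simp [ht, g]
  have h1 := (F.continuous.tendsto y).comp hlim
  have h2 := (G.continuous.tendsto y).comp hlim
  exact tendsto_nhds_unique h1 (h2.congr fun m => (hFG m).symm)

theorem exists_dual_equiv_tildeNorm (hp : IsExponent p) :
    ∃ e : StrongDual ℝ (lpZero p (isExtendedNorm_tildeNorm hp)) ≃L[ℝ]
        FiniteSpace (isExtendedNorm_tildeNorm hp.conj),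
      ∀ F, Represents (fun x => x.1.toL0) F (e F).toL0 ∧ ‖F‖ = ‖e F‖ := by
  refine exists_dual_equiv (fun _ _ => rfl) (fun _ _ => rfl) _ (hasHolder_tilde hp)
    (fun f ε hε => ?_) (exists_representing_tilde hp)
  obtain ⟨C, hC, hCf⟩ := exists_toReal_tildeNorm_sub_le f.lt_top (half_pos hε)
  have hC' : C ∈ lusinSets p := lusinSets_conj hp ▸ hC
  have hb := isBddExponent_lusinExponent hp hC'
  have hfC := memLpVar_indicator hp.conj hC f.toL0.aemeasurable f.lt_top
  rw [← conj_lusinExponent] at hfC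
  obtain ⟨x, hx, hx1, hxf⟩ := exists_norming hb hfC.1 hfC.2 (half_pos hε)
  have hxm : MemLpVar (lusinExponent p C) x := ⟨hx, hx1.trans_lt ENNReal.one_lt_top⟩
  refine ⟨restrictLusin hp hC' x hxm, ?_, ?_⟩
  · refine (norm_restrictLusin_le hp hC' hxm).trans ?_
    simpa using ENNReal.toReal_mono ENNReal.one_ne_top hx1
  · rw [conj_lusinExponent, ← lpNorm_indicator_eq hp.conj] at hxf
    have e : ∫ t, x t * C.indicator f.toL0 t ∂unitMeasure =
        ∫ t, (restrictLusin hp hC' x hxm).1.toL0 t * f.toL0 t ∂unitMeasure := by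
      refine integral_congr_ae ?_
      filter_upwards [coeFn_restrictLusin hp hC' hxm] with t ht
      rw [ht]
      by_cases htC : t ∈ C <;> simp [htC]
    rw [← e, FiniteSpace.norm_eq]
    linarith

end OdeLp

theorem mainTheorem2 (a : ℝ) (ha₁ : 1 < a) (ha₂ : a < 2) (ha : a ^ a = Real.exp 1) :
    (∀ p : ℝ → ℝ, AEMeasurable p OdeLp.unitMeasure → (∀ t ∈ Set.Icc (0 : ℝ) 1, 1 ≤ p t) →
      1 < essInf (fun t => (p t : EReal)) OdeLp.unitMeasure →
      essSup (fun t => (p t : EReal)) OdeLp.unitMeasure < ⊤ →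
      ∃ (hp : OdeLp.IsExtendedNorm (OdeLp.lpNorm p))
        (hq : OdeLp.IsExtendedNorm (OdeLp.lpNorm (OdeLp.conj p)))
        (e : StrongDual ℝ (OdeLp.FiniteSpace hp) ≃L[ℝ] OdeLp.FiniteSpace hq),
        ∀ F : StrongDual ℝ (OdeLp.FiniteSpace hp),
          OdeLp.Represents (fun x => x.toL0) F (e F).toL0 ∧
          ‖F‖ ≤ ‖e F‖ ∧ ‖e F‖ ≤ (1 + a * Real.exp 1) * ‖F‖) ∧
    (∀ p : ℝ → ℝ, AEMeasurable p OdeLp.unitMeasure → (∀ t ∈ Set.Icc (0 : ℝ) 1, 1 < p t) →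
      ∃ (hp : OdeLp.IsExtendedNorm (OdeLp.tildeNorm p))
        (hq : OdeLp.IsExtendedNorm (OdeLp.tildeNorm (OdeLp.conj p)))
        (e : StrongDual ℝ (OdeLp.lpZero p hp) ≃L[ℝ] OdeLp.FiniteSpace hq),
        ∀ F : StrongDual ℝ (OdeLp.lpZero p hp),
          OdeLp.Represents (fun x => x.1.toL0) F (e F).toL0 ∧
          ‖F‖ ≤ ‖e F‖ ∧ ‖e F‖ ≤ (1 + a * Real.exp 1) * ‖F‖) := by
  have hle : ∀ r : ℝ, 0 ≤ r → r ≤ (1 + a * Real.exp 1) * r := fun r hr => by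
    have h1 : 0 ≤ a * Real.exp 1 := mul_nonneg (by linarith) (Real.exp_pos 1).le
    exact le_mul_of_one_le_left hr (by linarith)
  constructor
  · intro p hp _ h1 h2
    have hb := OdeLp.IsBddExponent.of_essInf_essSup hp h1 h2
    obtain ⟨e, he⟩ := OdeLp.exists_dual_equiv_lpNorm hb
    exact ⟨_, _, e, fun F => ⟨(he F).1, (he F).2.le, (he F).2 ▸ hle _ (norm_nonneg F)⟩⟩
  · intro p hp h1
    obtain ⟨e, he⟩ := OdeLp.exists_dual_equiv_tildeNorm ⟨hp, h1⟩
    exact ⟨_, _, e, fun F => ⟨(he F).1, (he F).2.le, (he F).2 ▸ hle _ (norm_nonneg F)⟩⟩
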